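/- Let $\overline{\mathbb C}=\mathbb C\cup\{\infty\}$ be the Riemann sphere and $\Delta\subset\mathbb C$ the open unit disc. For a domain (nonempty connected open set) $D\subset\mathbb C$ and $z\in D$ let $$s_D(z)=\sup_f\ \sup\{r : \{|w|<r\}\subset f(D)\},$$ where $f$ ranges over the injective holomorphic maps $f:D\to\Delta$ with $f(z)=0$; put $s_D(z)=0$ if there is no such $f$. Call $D$ holomorphic homogeneous regular if $s_D\ge c$ on $D$ for some constant $c>0$. For a domain $X\subset\overline{\mathbb C}$ let $K_X$ be the Kobayashi (pseudo)distance of $X$, that is, $K_X(x,y)$ is the infimum of $\sum_i\rho(a_i,b_i)$ over all finite chains of points $x=x_0,\dots,x_m=y$ of $X$, holomorphic maps $f_i:\Delta\to X$ and points $a_i,b_i\in\Delta$ with $f_i(a_i)=x_{i-1}$, $f_i(b_i)=x_i$, where $\rho$ is the Poincaré distance of $\Delta$, normalized by $\rho(0,w)=\log\frac{1+|w|}{1-|w|}$. **Theorem.** Let $D\subset\mathbb C$ be a domain such that $\overline{\mathbb C}\setminus D$ has only finitely many connected components, and let $E$ be one of these components. (1) If $E$ is not a single point, then $s_D(z)\to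 1$ as $z\in D$ tends to $E$ in $\overline{\mathbb C}$; that is, for every $\varepsilon>0$ there is a neighbourhood $U$ of $E$ in $\overline{\mathbb C}$ with $|s_D(z)-1|<\varepsilon$ for all $z\in D\cap U$. (2) If $E=\{p\}$ is a single point ($p=\infty$ being allowed), then $\tilde D=D\cup\{p\}$ is a domain in $\overline{\mathbb C}$ and $$s_D(z)\le\tanh\left(\tfrac12 K_{\tilde D}(z,p)\right)\qquad\text{for all } z\in D;$$ moreover $s_D(z)\to 0$ as $z\in D$ tends to $p$. Consequently, $D$ is holomorphic homogeneous regular if and only if no connected component of $\overline{\mathbb C}\setminus D$ is a single point. -/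

import Mathlib

open Set Filter Topology Metric

noncomputable section

/-- `D` is a planar domain: a nonempty connected open subset of `ℂ`. -/
def IsPlanarDomain (D : Set ℂ) : Prop :=
  IsOpen D ∧ IsConnected D

/-- The Riemann sphere, as the one-point compactification of `ℂ`. -/
abbrev RiemannSphere : Type := OnePoint ℂ

/-- A subset of the plane, regarded as a subset of the Riemann sphere. -/
def toSphere (D : Set ℂ) : Set RiemannSphere :=
  (fun z : ℂ => (z : RiemannSphere)) '' D

/-- The set of connected components of the complement of `D` in the Riemann sphere. -/
def complementComponents (D : Set ℂ) : Set (Set RiemannSphere) :=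
  {E | ∃ x ∈ (toSphere D)ᶜ, E = connectedComponentIn (toSphere D)ᶜ x}

/-- `D` is finitely connected: its complement in the Riemann sphere has finitely many
connected components. -/
def FinitelyConnected (D : Set ℂ) : Prop :=
  (complementComponents D).Finite

/-- The filter `D ∋ z → E` for a subset `E` of the Riemann sphere: a property holds eventually
if it holds at all points of `D` lying in some neighbourhood of `E` in the sphere. -/
def approach (D : Set ℂ) (E : Set RiemannSphere) : Filter ℂ :=
  comap (fun z : ℂ => (z : RiemannSphere)) (𝓝ˢ E) ⊓ 𝓟 D

/-! ### Squeezing function -/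

/-- `f` is a holomorphic embedding of `D` into the open unit disc with `f p = 0`. (For an open
set in the plane an injective holomorphic function is biholomorphic onto an open image.) -/
def IsDiscEmbedding (D : Set ℂ) (p : ℂ) (f : ℂ → ℂ) : Prop :=
  DifferentiableOn ℂ f D ∧ InjOn f D ∧ MapsTo f D (ball 0 1) ∧ f p = 0

/-- `s_D(p, f)`, the supremum of the `r` such that the disc of radius `r` about `0` is contained
in `f(D)`. -/
def squeezingOf (D : Set ℂ) (f : ℂ → ℂ) : ℝ :=
  sSup {r : ℝ | ball (0 : ℂ) r ⊆ f '' D}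

/-- The squeezing function `s_D(p)`, the supremum of `s_D(p, f)` over all holomorphic embeddings
`f` of `D` into the unit disc with `f p = 0`; it is `0` if there is no such embedding. -/
def squeezing (D : Set ℂ) (p : ℂ) : ℝ :=
  sSup {s : ℝ | ∃ f : ℂ → ℂ, IsDiscEmbedding D p f ∧ s = squeezingOf D f}

/-- `D` is holomorphic homogeneous regular: its squeezing function has a positive lower bound. -/
def IsHolomorphicHomogeneousRegular (D : Set ℂ) : Prop :=
  ∃ c : ℝ, 0 < c ∧ ∀ z ∈ D, c ≤ squeezing D z

/-! ### Kobayashi distance on subsets of the Riemann sphere -/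

/-- The affine coordinate on the sphere minus `∞` (with a dummy value at `∞`). -/
def affineCoord (x : RiemannSphere) : ℂ := x.elim 0 (fun z => z)

/-- The coordinate `1/z` on the sphere minus `0`, with value `0` at `∞` (and a dummy value
at `0`). -/
def inverseCoord (x : RiemannSphere) : ℂ := x.elim 0 (fun z => z⁻¹)

/-- `f` is holomorphic on the open set `U` as a map into the Riemann sphere: it is continuous,
and it is complex differentiable at every point of `U` when read in any of the two coordinates
that is defined at the value. -/
def HolomorphicToSphereOn (f : ℂ → RiemannSphere) (U : Set ℂ) : Prop :=
  ContinuousOn f U ∧ ∀ z ∈ U,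
    (f z ≠ OnePoint.infty → DifferentiableAt ℂ (fun w => affineCoord (f w)) z) ∧
    (f z ≠ ((0 : ℂ) : RiemannSphere) → DifferentiableAt ℂ (fun w => inverseCoord (f w)) z)

/-- The function `σ(c) = log ((1 + c) / (1 - c))`, with inverse `w ↦ tanh (w / 2)`. -/
def sigma (c : ℝ) : ℝ := Real.log ((1 + c) / (1 - c))

/-- The Poincaré distance on the unit disc, normalized so that `0` and `z` have distance
`σ(|z|)`. -/
def poincareDist (a b : ℂ) : ℝ :=
  sigma ‖(a - b) / (1 - (starRingEnd ℂ) a * b)‖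

/-- `DiscChain X x y L`: there is a finite chain of holomorphic discs in `X` joining `x` to `y`,
of total Poincaré length `L`. -/
inductive DiscChain (X : Set RiemannSphere) : RiemannSphere → RiemannSphere → ℝ → Prop
  | refl (x : RiemannSphere) (hx : x ∈ X) : DiscChain X x x 0
  | step {x y z : RiemannSphere} {L : ℝ} (h : DiscChain X x y L)
      (f : ℂ → RiemannSphere) (a b : ℂ)
      (hf : HolomorphicToSphereOn f (ball 0 1)) (hX : MapsTo f (ball 0 1) X)
      (ha : a ∈ ball (0 : ℂ) 1) (hb : b ∈ ball (0 : ℂ) 1) (hfa : f a = y) (hfb : f b = z) :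
      DiscChain X x z (L + poincareDist a b)

/-- The Kobayashi (pseudo)distance on the subset `X` of the Riemann sphere: the infimum of the
lengths of the chains of holomorphic discs in `X` joining the two points. -/
def kobayashiDist (X : Set RiemannSphere) (x y : RiemannSphere) : ℝ :=
  sInf {L : ℝ | DiscChain X x y L}

end

/-! Both cases rest on the fact that holomorphic maps do not increase the Poincaré and Kobayashi
distances.

Nondegenerate `E`. A Möbius map sending a point of `E` to `∞` turns the complement of `E` into a
plane domain `U`, not the whole plane, with connected complement in the sphere, and it turns `D`
into `U` minus a compact set `K` (`exists_planar_model`). Such a `U` is simply connected, so it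
embeds in the disc with any given point going to `0` and with image containing any given disc of
radius `ρ < 1` (`exists_isDiscEmbedding_ball_subset`). As `z` tends to `E`, its image leaves every
compact subset of `U`, hence is hyperbolically far from `K`, and the embedding centred there pushes
`K` out of the disc of radius `ρ` (`exists_isDiscEmbedding_ball_subset_diff`). Restricting it to `D`
gives a squeezing function of at least `ρ`.

The weak Riemann mapping theorem used here needs only square roots of `z - c`. They come from
connectedness of the complement, by moving a second zero from `c` to `∞` (`exists_sq_eq_sub`); that
connectedness passes to the image of the root (`isPreconnected_compl_toSphere_sqrt_image`). As only
radii below `1` matter, a nearly maximal derivative suffices in Koebe's argument, and no normal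
families are needed.

Puncture `E = {p}`. A disc embedding extends over `p` to a map `F` whose value at `p` is not in the
image of `D` (`exists_extension`). Every disc about `0` inside the image therefore has radius at
most `‖F p‖`, which the Kobayashi distance from `z` to `p` controls; that distance tends to `0` at
`p`.

The final equivalence follows from compactness of the sphere in one direction and from the limit `0`
in the other. -/

/-! ### Automorphisms of the disc and the Poincaré distance -/

/-- The automorphism `w ↦ (w - a) / (1 - conj a * w)` of the unit disc. -/
noncomputable def discAut (a w : ℂ) : ℂ := (w - a) / (1 - (starRingEnd ℂ) a * w)

@[simp] theorem discAut_self (a : ℂ) : discAut a a = 0 := by simp [discAut]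

@[simp] theorem discAut_zero_left (w : ℂ) : discAut 0 w = w := by simp [discAut]

@[simp] theorem discAut_zero_right (a : ℂ) : discAut a 0 = -a := by simp [discAut]

theorem one_sub_conj_mul_ne_zero {a w : ℂ} (ha : ‖a‖ < 1) (hw : ‖w‖ < 1) :
    1 - (starRingEnd ℂ) a * w ≠ 0 := by
  intro h
  have h1 : ‖(starRingEnd ℂ) a * w‖ = 1 := by
    rw [← sub_eq_zero.1 h]; simp
  rw [norm_mul, RCLike.norm_conj] at h1
  nlinarith [norm_nonneg a, norm_nonneg w]

theorem norm_one_sub_conj_mul_sq (a w : ℂ) :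
    ‖1 - (starRingEnd ℂ) a * w‖ ^ 2 = ‖w - a‖ ^ 2 + (1 - ‖a‖ ^ 2) * (1 - ‖w‖ ^ 2) := by
  simp only [Complex.sq_norm, Complex.normSq_apply]
  simp
  ring

theorem norm_discAut_lt_one {a w : ℂ} (ha : ‖a‖ < 1) (hw : ‖w‖ < 1) : ‖discAut a w‖ < 1 := by
  have h0 := norm_pos_iff.2 (one_sub_conj_mul_ne_zero ha hw)
  rw [discAut, norm_div, div_lt_one h0]
  refine lt_of_pow_lt_pow_left₀ 2 h0.le ?_
  rw [norm_one_sub_conj_mul_sq]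
  have h1 : 0 < 1 - ‖a‖ ^ 2 := by nlinarith [norm_nonneg a]
  have h2 : 0 < 1 - ‖w‖ ^ 2 := by nlinarith [norm_nonneg w]
  nlinarith [mul_pos h1 h2]

theorem norm_discAut_comm (a w : ℂ) : ‖discAut a w‖ = ‖discAut w a‖ := by
  have : (1 - (starRingEnd ℂ) a * w) = (starRingEnd ℂ) (1 - (starRingEnd ℂ) w * a) := by
    simp [mul_comm]
  rw [discAut, discAut, norm_div, norm_div, this, RCLike.norm_conj, norm_sub_rev]

theorem discAut_neg_discAut {a w : ℂ} (ha : ‖a‖ < 1) (hw : ‖w‖ < 1) :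
    discAut (-a) (discAut a w) = w := by
  have h0 := one_sub_conj_mul_ne_zero ha hw
  have h1 := one_sub_conj_mul_ne_zero ha ha
  have hu : discAut a w * (1 - (starRingEnd ℂ) a * w) = w - a := div_mul_cancel₀ _ h0
  rw [discAut.eq_1 (-a)]
  generalize discAut a w = u at hu
  have h2 : 1 - (starRingEnd ℂ) (-a) * u ≠ 0 := by
    intro h
    rw [map_neg] at h
    exact h1 (by linear_combination (1 - (starRingEnd ℂ) a * w) * h - (starRingEnd ℂ) a * hu)
  rw [div_eq_iff h2]
  apply mul_right_cancel₀ h0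
  rw [map_neg]
  linear_combination (1 - (starRingEnd ℂ) a * w) * hu

theorem discAut_discAut_neg {a w : ℂ} (ha : ‖a‖ < 1) (hw : ‖w‖ < 1) :
    discAut a (discAut (-a) w) = w := by
  have := discAut_neg_discAut (a := -a) (w := w) (by simpa using ha) hw
  simpa using this

theorem mapsTo_discAut {a : ℂ} (ha : ‖a‖ < 1) : MapsTo (discAut a) (ball 0 1) (ball 0 1) := by
  intro w hw
  simpa using norm_discAut_lt_one ha (by simpa using hw)

theorem injOn_discAut {a : ℂ} (ha : ‖a‖ < 1) : InjOn (discAut a) (ball 0 1) := by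
  intro x hx y hy h
  rw [← discAut_neg_discAut ha (by simpa using hx : ‖x‖ < 1), h,
    discAut_neg_discAut ha (by simpa using hy : ‖y‖ < 1)]

theorem hasDerivAt_discAut {a w : ℂ} (ha : ‖a‖ < 1) (hw : ‖w‖ < 1) :
    HasDerivAt (discAut a)
      ((1 - (‖a‖ : ℂ) ^ 2) / (1 - (starRingEnd ℂ) a * w) ^ 2) w := by
  have h0 := one_sub_conj_mul_ne_zero ha hw
  have h1 : HasDerivAt (fun w : ℂ => w - a) 1 w := (hasDerivAt_id w).sub_const a
  have h2 : HasDerivAt (fun w : ℂ => 1 - (starRingEnd ℂ) a * w) (-((starRingEnd ℂ) a * 1)) w :=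
    ((hasDerivAt_id w).const_mul _).const_sub 1
  refine (h1.div h2 h0).congr_deriv ?_
  rw [← Complex.conj_mul']
  congr 1
  ring

theorem differentiableOn_discAut {a : ℂ} (ha : ‖a‖ < 1) :
    DifferentiableOn ℂ (discAut a) (ball 0 1) := fun w hw =>
  (hasDerivAt_discAut ha (by simpa using hw)).differentiableAt.differentiableWithinAt

/-- **Schwarz–Pick lemma.** -/
theorem norm_discAut_map_le {f : ℂ → ℂ} (hf : DifferentiableOn ℂ f (ball 0 1))
    (hm : MapsTo f (ball 0 1) (ball 0 1)) {a b : ℂ} (ha : ‖a‖ < 1) (hb : ‖b‖ < 1) :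
    ‖discAut (f a) (f b)‖ ≤ ‖discAut a b‖ := by
  have ha' : ‖-a‖ < 1 := by simpa using ha
  have hfa : ‖f a‖ < 1 := by simpa using hm (by simpa using ha : a ∈ ball (0 : ℂ) 1)
  have hc := (differentiableOn_discAut hfa).comp
    (hf.comp (differentiableOn_discAut ha') (mapsTo_discAut ha'))
    (hm.comp (mapsTo_discAut ha'))
  have hcm := (mapsTo_discAut hfa).comp (hm.comp (mapsTo_discAut ha'))
  have := Complex.norm_le_norm_of_mapsTo_ball hc (fun x hx => ball_subset_closedBall (hcm hx)) (by simp)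
    (norm_discAut_lt_one ha hb)
  simpa [discAut_neg_discAut ha hb] using this

/-- This is the triangle inequality through `0`: by `sigma_add`, the right-hand side corresponds to
the sum of the distances of `a` and `b` from `0`. -/
theorem norm_discAut_le_add_div {a b : ℂ} (ha : ‖a‖ < 1) (hb : ‖b‖ < 1) :
    ‖discAut a b‖ ≤ (‖a‖ + ‖b‖) / (1 + ‖a‖ * ‖b‖) := by
  have h0 := norm_pos_iff.2 (one_sub_conj_mul_ne_zero ha hb)
  rw [discAut, norm_div, div_le_div_iff₀ h0 (by positivity)]
  refine le_of_sq_le_sq ?_ (by positivity)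
  rw [mul_pow, mul_pow, norm_one_sub_conj_mul_sq]
  have h1 : 0 < 1 - ‖a‖ ^ 2 := by nlinarith [norm_nonneg a]
  have h2 : 0 < 1 - ‖b‖ ^ 2 := by nlinarith [norm_nonneg b]
  have h3 : ‖b - a‖ ^ 2 ≤ (‖a‖ + ‖b‖) ^ 2 := by
    gcongr
    exact (norm_sub_le _ _).trans_eq (add_comm _ _)
  nlinarith [mul_le_mul_of_nonneg_right h3 (mul_pos h1 h2).le]

theorem poincareDist_eq (a b : ℂ) : poincareDist a b = sigma ‖discAut a b‖ := by
  rw [poincareDist, discAut, norm_div, norm_div, norm_sub_rev]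

theorem sigma_eq_two_mul_artanh {c : ℝ} (h0 : 0 ≤ c) (h1 : c < 1) :
    sigma c = 2 * Real.artanh c := by
  rw [sigma, Real.artanh_eq_half_log ⟨by linarith, h1.le⟩]
  ring

theorem tanh_half_sigma {c : ℝ} (h0 : 0 ≤ c) (h1 : c < 1) : Real.tanh (sigma c / 2) = c := by
  rw [sigma_eq_two_mul_artanh h0 h1, mul_div_cancel_left₀ _ two_ne_zero,
    Real.tanh_artanh ⟨by linarith, h1⟩]

theorem tanh_monotone : Monotone Real.tanh := by
  intro x y hxy
  by_contra! h
  have := Real.strictMonoOn_artanh (a := Real.tanh y) ⟨Real.neg_one_lt_tanh y, Real.tanh_lt_one y⟩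
    ⟨Real.neg_one_lt_tanh x, Real.tanh_lt_one x⟩ h
  rw [Real.artanh_tanh, Real.artanh_tanh] at this
  linarith

theorem sigma_mono {x y : ℝ} (h0 : 0 ≤ x) (hxy : x ≤ y) (h1 : y < 1) : sigma x ≤ sigma y := by
  rw [sigma_eq_two_mul_artanh h0 (hxy.trans_lt h1), sigma_eq_two_mul_artanh (h0.trans hxy) h1]
  have := Real.artanh_le_artanh (by linarith) h1 hxy
  linarith

theorem sigma_nonneg {x : ℝ} (h0 : 0 ≤ x) (h1 : x < 1) : 0 ≤ sigma x := by
  simpa [sigma] using sigma_mono le_rfl h0 h1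

theorem sigma_add {x y : ℝ} (hx : 0 ≤ x) (hx1 : x < 1) (hy : 0 ≤ y) (hy1 : y < 1) :
    sigma ((x + y) / (1 + x * y)) = sigma x + sigma y := by
  have h : 0 < 1 + x * y := by positivity
  have hx2 : 0 < 1 - x := by linarith
  have hy2 : 0 < 1 - y := by linarith
  rw [sigma, sigma, sigma, ← Real.log_mul (by positivity) (by positivity)]
  congr 1
  have h1 : 1 - (x + y) / (1 + x * y) = (1 - x) * (1 - y) / (1 + x * y) := by
    field_simp
    ring
  rw [h1]
  field_simp
  ring

theorem poincareDist_nonneg {a b : ℂ} (ha : ‖a‖ < 1) (hb : ‖b‖ < 1) : 0 ≤ poincareDist a b := by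
  rw [poincareDist_eq]
  exact sigma_nonneg (norm_nonneg _) (norm_discAut_lt_one ha hb)

theorem poincareDist_comm (a b : ℂ) : poincareDist a b = poincareDist b a := by
  rw [poincareDist_eq, poincareDist_eq, norm_discAut_comm]

theorem add_div_one_add_mul_lt_one {x y : ℝ} (hx : 0 ≤ x) (hx1 : x < 1) (hy : 0 ≤ y)
    (hy1 : y < 1) : (x + y) / (1 + x * y) < 1 := by
  rw [div_lt_one (by positivity)]
  nlinarith

theorem poincareDist_map_le {f : ℂ → ℂ} (hf : DifferentiableOn ℂ f (ball 0 1))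
    (hm : MapsTo f (ball 0 1) (ball 0 1)) {a b : ℂ} (ha : ‖a‖ < 1) (hb : ‖b‖ < 1) :
    poincareDist (f a) (f b) ≤ poincareDist a b := by
  rw [poincareDist_eq, poincareDist_eq]
  exact sigma_mono (norm_nonneg _) (norm_discAut_map_le hf hm ha hb) (norm_discAut_lt_one ha hb)

theorem poincareDist_triangle {a b c : ℂ} (ha : ‖a‖ < 1) (hb : ‖b‖ < 1) (hc : ‖c‖ < 1) :
    poincareDist a c ≤ poincareDist a b + poincareDist b c := by
  have hb' : ‖-b‖ < 1 := by simpa using hb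
  have hua := norm_discAut_lt_one hb ha
  have huc := norm_discAut_lt_one hb hc
  have h1 := poincareDist_map_le (differentiableOn_discAut hb') (mapsTo_discAut hb') hua huc
  rw [discAut_neg_discAut hb ha, discAut_neg_discAut hb hc] at h1
  rw [poincareDist_comm a b]
  refine h1.trans ?_
  rw [poincareDist_eq, poincareDist_eq, poincareDist_eq,
    ← sigma_add (norm_nonneg _) hua (norm_nonneg _) huc]
  exact sigma_mono (norm_nonneg _) (norm_discAut_le_add_div hua huc)
    (add_div_one_add_mul_lt_one (norm_nonneg _) hua (norm_nonneg _) huc)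

theorem norm_eq_tanh_poincareDist {a : ℂ} (ha : ‖a‖ < 1) :
    ‖a‖ = Real.tanh (poincareDist 0 a / 2) := by
  rw [poincareDist_eq, discAut_zero_left, tanh_half_sigma (norm_nonneg a) ha]

/-! ### Injective holomorphic functions -/

theorem nhds_le_map_nhds_of_injOn {U : Set ℂ} {f : ℂ → ℂ} (hU : IsOpen U)
    (hf : DifferentiableOn ℂ f U) (hi : InjOn f U) {x : ℂ} (hx : x ∈ U) :
    𝓝 (f x) ≤ map f (𝓝 x) := by
  refine (hf.analyticAt (hU.mem_nhds hx)).eventually_constant_or_nhds_le_map_nhds.resolve_left ?_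
  intro h
  have h1 : ∀ᶠ z in 𝓝[≠] x, z ∈ U ∧ f z = f x ∧ z ≠ x := by
    filter_upwards [(hU.eventually_mem hx).filter_mono nhdsWithin_le_nhds,
      h.filter_mono nhdsWithin_le_nhds, self_mem_nhdsWithin] with z h1 h2 h3
    exact ⟨h1, h2, h3⟩
  obtain ⟨z, h1, h2, h3⟩ := h1.exists
  exact h3 (hi h1 hx h2)

theorem isOpen_image_of_injOn {U V : Set ℂ} {f : ℂ → ℂ} (hU : IsOpen U)
    (hf : DifferentiableOn ℂ f U) (hi : InjOn f U) (hV : IsOpen V) (hVU : V ⊆ U) :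
    IsOpen (f '' V) := by
  rw [isOpen_iff_mem_nhds]
  rintro _ ⟨x, hx, rfl⟩
  exact nhds_le_map_nhds_of_injOn hU hf hi (hVU hx) (image_mem_map (hV.mem_nhds hx))

theorem continuousOn_invFunOn {U : Set ℂ} {f : ℂ → ℂ} (hU : IsOpen U)
    (hf : DifferentiableOn ℂ f U) (hi : InjOn f U) :
    ContinuousOn (Function.invFunOn f U) (f '' U) := by
  rintro _ ⟨x, hx, rfl⟩
  refine ContinuousAt.continuousWithinAt ?_
  rw [ContinuousAt, hi.leftInvOn_invFunOn hx]
  refine Tendsto.mono_left ?_ (nhds_le_map_nhds_of_injOn hU hf hi hx)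
  rw [tendsto_map'_iff]
  refine tendsto_id.congr' ?_
  filter_upwards [hU.mem_nhds hx] with z hz
  exact (hi.leftInvOn_invFunOn hz).symm

theorem differentiableAt_invFunOn_of_deriv_ne_zero {U : Set ℂ} {f : ℂ → ℂ} (hU : IsOpen U)
    (hf : DifferentiableOn ℂ f U) (hi : InjOn f U) {x : ℂ} (hx : x ∈ U) (h : deriv f x ≠ 0) :
    DifferentiableAt ℂ (Function.invFunOn f U) (f x) := by
  have hV := isOpen_image_of_injOn hU hf hi hU Subset.rfl
  have hc := (continuousOn_invFunOn hU hf hi).continuousAt (hV.mem_nhds (mem_image_of_mem f hx))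
  refine (HasDerivAt.of_local_left_inverse (f := f) (f' := deriv f x) hc ?_ h ?_).differentiableAt
  · rw [hi.leftInvOn_invFunOn hx]
    exact (hf.differentiableAt (hU.mem_nhds hx)).hasDerivAt
  · filter_upwards [hV.mem_nhds (mem_image_of_mem f hx)] with y hy
    exact Function.invFunOn_eq hy

/-- Zeros of `deriv f` are isolated, since otherwise `f` would be constant near one of them. The
inverse is thus differentiable off isolated points and continuous there, so the singularities are
removable. That `deriv f` has no zeros at all is then a consequence, by the chain rule. -/
theorem differentiableOn_invFunOn {U : Set ℂ} {f : ℂ → ℂ} (hU : IsOpen U)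
    (hf : DifferentiableOn ℂ f U) (hi : InjOn f U) :
    DifferentiableOn ℂ (Function.invFunOn f U) (f '' U) := by
  rintro _ ⟨x, hx, rfl⟩
  have hV := isOpen_image_of_injOn hU hf hi hU Subset.rfl
  have hc := (continuousOn_invFunOn hU hf hi).continuousAt (hV.mem_nhds (mem_image_of_mem f hx))
  refine (Complex.analyticAt_of_differentiable_on_punctured_nhds_of_continuousAt ?_
    hc).differentiableAt.differentiableWithinAt
  have ha := hf.analyticAt (hU.mem_nhds hx)
  have h1 : ∀ᶠ z in 𝓝[≠] x, deriv f z ≠ 0 := by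
    refine ha.deriv.eventually_eq_zero_or_eventually_ne_zero.resolve_left fun h => ?_
    obtain ⟨r, hr, h⟩ := Metric.eventually_nhds_iff_ball.1 (h.and (hU.eventually_mem hx))
    have hball : ∀ z ∈ ball x r, f z = f x := fun z hz =>
      isOpen_ball.is_const_of_deriv_eq_zero (convex_ball x r).isPreconnected
        (hf.mono fun y hy => (h y hy).2) (fun y hy => (h y hy).1) hz (mem_ball_self hr)
    have : ∃ z ∈ ball x r, z ≠ x := by
      refine ⟨x + (r / 2 : ℝ), ?_, ?_⟩
      · simp [abs_of_pos hr, hr]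
      · simp [hr.ne']
    obtain ⟨z, hz, hzx⟩ := this
    exact hzx (hi (h z hz).2 hx (hball z hz))
  have h2 : Tendsto (Function.invFunOn f U) (𝓝[≠] (f x)) (𝓝[≠] x) := by
    refine tendsto_nhdsWithin_iff.2 ⟨?_, ?_⟩
    · have := hc.tendsto
      rw [hi.leftInvOn_invFunOn hx] at this
      exact this.mono_left nhdsWithin_le_nhds
    · filter_upwards [self_mem_nhdsWithin,
        (hV.eventually_mem (mem_image_of_mem f hx)).filter_mono nhdsWithin_le_nhds]
        with y hy hyV hyx
      have hyx' : Function.invFunOn f U y = x := hyx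
      exact hy (by rw [mem_singleton_iff, ← hyx', Function.invFunOn_eq hyV])
  filter_upwards [h2.eventually h1,
    (hV.eventually_mem (mem_image_of_mem f hx)).filter_mono nhdsWithin_le_nhds]
  rintro _ hd ⟨z, hz, rfl⟩
  rw [hi.leftInvOn_invFunOn hz] at hd
  exact differentiableAt_invFunOn_of_deriv_ne_zero hU hf hi hz hd

theorem deriv_ne_zero_of_injOn {U : Set ℂ} {f : ℂ → ℂ} (hU : IsOpen U)
    (hf : DifferentiableOn ℂ f U) (hi : InjOn f U) {x : ℂ} (hx : x ∈ U) : deriv f x ≠ 0 := by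
  intro h0
  have hV := isOpen_image_of_injOn hU hf hi hU Subset.rfl
  have h1 := ((differentiableOn_invFunOn hU hf hi).differentiableAt
    (hV.mem_nhds (mem_image_of_mem f hx))).hasDerivAt
  have h2 := h1.comp x (hf.differentiableAt (hU.mem_nhds hx)).hasDerivAt
  rw [h0, mul_zero] at h2
  have h3 : HasDerivAt (fun z : ℂ => z) 0 x := by
    refine h2.congr_of_eventuallyEq ?_
    filter_upwards [hU.mem_nhds hx] with z hz
    exact (hi.leftInvOn_invFunOn hz).symm
  exact zero_ne_one (h3.unique (hasDerivAt_id' x))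

/-! ### The Riemann sphere -/

open scoped Classical in
/-- The inversion `z ↦ 1 / z` of the Riemann sphere. -/
noncomputable def sphereInv (x : RiemannSphere) : RiemannSphere :=
  x.elim ((0 : ℂ) : RiemannSphere) fun z => if z = 0 then OnePoint.infty else ((z⁻¹ : ℂ) : RiemannSphere)

@[simp] theorem sphereInv_infty : sphereInv OnePoint.infty = ((0 : ℂ) : RiemannSphere) := rfl

@[simp] theorem sphereInv_zero : sphereInv ((0 : ℂ) : RiemannSphere) = OnePoint.infty := by
  simp [sphereInv]

theorem sphereInv_coe {z : ℂ} (hz : z ≠ 0) :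
    sphereInv (z : RiemannSphere) = ((z⁻¹ : ℂ) : RiemannSphere) := by
  simp [sphereInv, hz]

theorem sphereInv_sphereInv (x : RiemannSphere) : sphereInv (sphereInv x) = x := by
  induction x using OnePoint.rec with
  | infty => simp
  | coe z =>
    by_cases hz : z = 0
    · simp [hz]
    · rw [sphereInv_coe hz, sphereInv_coe (inv_ne_zero hz), inv_inv]

theorem comap_coe_nhds_infty_eq_cobounded :
    comap (fun z : ℂ => (z : RiemannSphere)) (𝓝 OnePoint.infty) = Bornology.cobounded ℂ := by
  rw [OnePoint.comap_coe_nhds_infty, Filter.coclosedCompact_eq_cocompact,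
    Metric.cobounded_eq_cocompact]

theorem tendsto_coe_cobounded :
    Tendsto (fun z : ℂ => (z : RiemannSphere)) (Bornology.cobounded ℂ) (𝓝 OnePoint.infty) := by
  rw [← comap_coe_nhds_infty_eq_cobounded]
  exact tendsto_comap

theorem continuous_sphereInv : Continuous sphereInv := by
  rw [OnePoint.continuous_iff]
  constructor
  · rw [Filter.coclosedCompact_eq_cocompact, ← Metric.cobounded_eq_cocompact, sphereInv_infty]
    have h := (OnePoint.continuous_coe.tendsto (0 : ℂ)).comp (tendsto_inv₀_cobounded (α := ℂ))
    refine h.congr' ?_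
    filter_upwards [Bornology.isBounded_singleton (x := (0 : ℂ))]
      with z hz
    exact (sphereInv_coe hz).symm
  · rw [continuous_iff_continuousAt]
    intro z
    by_cases hz : z = 0
    · subst hz
      rw [continuousAt_iff_punctured_nhds, sphereInv_zero]
      refine (tendsto_coe_cobounded.comp (tendsto_inv₀_nhdsNE_zero (α := ℂ))).congr' ?_
      filter_upwards [self_mem_nhdsWithin] with w hw
      exact (sphereInv_coe hw).symm
    · have h : ContinuousAt (fun w : ℂ => ((w⁻¹ : ℂ) : RiemannSphere)) z :=
        OnePoint.continuous_coe.continuousAt.comp (continuousAt_inv₀ hz)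
      refine h.congr ?_
      filter_upwards [isOpen_ne.mem_nhds hz] with w hw
      exact (sphereInv_coe hw).symm

/-- The inversion of the Riemann sphere, as a homeomorphism. -/
noncomputable def sphereInvHomeo : RiemannSphere ≃ₜ RiemannSphere where
  toFun := sphereInv
  invFun := sphereInv
  left_inv := sphereInv_sphereInv
  right_inv := sphereInv_sphereInv
  continuous_toFun := continuous_sphereInv
  continuous_invFun := continuous_sphereInv

@[simp] theorem affineCoord_coe (z : ℂ) : affineCoord (z : RiemannSphere) = z := rfl

@[simp] theorem inverseCoord_coe (z : ℂ) : inverseCoord (z : RiemannSphere) = z⁻¹ := rfl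

@[simp] theorem inverseCoord_infty : inverseCoord OnePoint.infty = 0 := rfl

theorem coe_affineCoord {x : RiemannSphere} (hx : x ≠ OnePoint.infty) :
    (affineCoord x : RiemannSphere) = x := by
  induction x using OnePoint.rec with
  | infty => exact absurd rfl hx
  | coe z => rfl

theorem inverseCoord_sphereInv_coe (z : ℂ) : inverseCoord (sphereInv (z : RiemannSphere)) = z := by
  by_cases hz : z = 0
  · simp [hz]
  · rw [sphereInv_coe hz, inverseCoord_coe, inv_inv]

theorem sphereInv_coe_inverseCoord {x : RiemannSphere} (hx : x ≠ ((0 : ℂ) : RiemannSphere)) :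
    sphereInv (inverseCoord x : RiemannSphere) = x := by
  induction x using OnePoint.rec with
  | infty => simp
  | coe z =>
    have hz : z ≠ 0 := fun h => hx (by rw [h])
    rw [inverseCoord_coe, sphereInv_coe (inv_ne_zero hz), inv_inv]

@[simp] theorem coe_mem_toSphere {D : Set ℂ} {z : ℂ} : (z : RiemannSphere) ∈ toSphere D ↔ z ∈ D :=
  OnePoint.coe_injective.mem_set_image

@[simp] theorem infty_notMem_toSphere {D : Set ℂ} : OnePoint.infty ∉ toSphere D :=
  OnePoint.infty_notMem_image_coe

theorem isOpen_toSphere {D : Set ℂ} (hD : IsOpen D) : IsOpen (toSphere D) :=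
  OnePoint.isOpen_image_coe.2 hD

theorem isConnected_toSphere {D : Set ℂ} (hD : IsConnected D) : IsConnected (toSphere D) :=
  hD.image _ OnePoint.continuous_coe.continuousOn

/-! ### Discs in the sphere and chains -/

theorem holomorphicToSphereOn_coe_comp {g : ℂ → ℂ} {U : Set ℂ} (hU : IsOpen U)
    (hg : DifferentiableOn ℂ g U) :
    HolomorphicToSphereOn (fun w => (g w : RiemannSphere)) U := by
  refine ⟨OnePoint.continuous_coe.comp_continuousOn hg.continuousOn, fun z hz => ⟨fun _ => ?_,
    fun h => ?_⟩⟩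
  · simpa using hg.differentiableAt (hU.mem_nhds hz)
  · have h0 : g z ≠ 0 := fun h0 => h (by simp [h0])
    simpa using! (hg.differentiableAt (hU.mem_nhds hz)).inv h0

theorem holomorphicToSphereOn_sphereInv_comp {g : ℂ → ℂ} {U : Set ℂ} (hU : IsOpen U)
    (hg : DifferentiableOn ℂ g U) :
    HolomorphicToSphereOn (fun w => sphereInv (g w : RiemannSphere)) U := by
  refine ⟨continuous_sphereInv.comp_continuousOn
    (OnePoint.continuous_coe.comp_continuousOn hg.continuousOn), fun z hz => ⟨fun h => ?_,
    fun _ => ?_⟩⟩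
  · have h0 : g z ≠ 0 := fun h0 => h (by simp [h0])
    have hd := hg.differentiableAt (hU.mem_nhds hz)
    refine (hd.inv h0).congr_of_eventuallyEq ?_
    filter_upwards [hd.continuousAt.eventually_ne h0] with w hw
    rw [sphereInv_coe hw, affineCoord_coe]
    rfl
  · simpa only [inverseCoord_sphereInv_coe] using hg.differentiableAt (hU.mem_nhds hz)

theorem exists_disc {X : Set RiemannSphere} (hX : IsOpen X) {x : RiemannSphere} (hx : x ∈ X) :
    ∃ φ : ℂ → RiemannSphere, HolomorphicToSphereOn φ (ball 0 1) ∧ MapsTo φ (ball 0 1) X ∧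
      φ 0 = x ∧ ∀ δ > 0, φ '' ball 0 δ ∈ 𝓝 x := by
  have key : ∀ (c : ℂ → RiemannSphere) (a : ℂ), IsOpenMap c → Continuous c → c a = x →
      (∀ r : ℝ, HolomorphicToSphereOn (fun w => c (a + r * w)) (ball 0 1)) →
      ∃ φ : ℂ → RiemannSphere, HolomorphicToSphereOn φ (ball 0 1) ∧ MapsTo φ (ball 0 1) X ∧
        φ 0 = x ∧ ∀ δ > 0, φ '' ball 0 δ ∈ 𝓝 x := by
    intro c a hco hcc hca hhol
    obtain ⟨r, hr, hrX⟩ := Metric.isOpen_iff.1 (hX.preimage hcc) a (by simpa [hca] using hx)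
    refine ⟨fun w => c (a + r * w), hhol r, fun w hw => hrX ?_, by simpa using hca, fun δ hδ => ?_⟩
    · have : ‖w‖ < 1 := by simpa using hw
      simp only [mem_ball, dist_eq_norm, add_sub_cancel_left, norm_mul, Complex.norm_real,
        Real.norm_eq_abs, abs_of_pos hr]
      nlinarith
    · have h1 : (fun w : ℂ => a + r * w) '' ball 0 δ ∈ 𝓝 a := by
        refine mem_of_superset (ball_mem_nhds a (mul_pos hr hδ)) fun z hz => ?_
        have hr' : (r : ℂ) ≠ 0 := by exact_mod_cast hr.ne'
        refine ⟨(z - a) / r, ?_, by field_simp; ring⟩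
        rw [mem_ball, dist_eq_norm] at hz
        simp only [mem_ball, dist_zero_right, norm_div, Complex.norm_real, Real.norm_eq_abs,
          abs_of_pos hr]
        rw [div_lt_iff₀ hr]
        linarith
      have h2 := hco.image_mem_nhds h1
      rwa [hca, image_image] at h2
  have hlin : ∀ (a : ℂ) (r : ℝ), DifferentiableOn ℂ (fun w : ℂ => a + r * w) (ball 0 1) :=
    fun a r => by fun_prop
  induction x using OnePoint.rec with
  | infty =>
    exact key (fun w => sphereInv w) 0 (sphereInvHomeo.isOpenMap.comp OnePoint.isOpenMap_coe)
      (continuous_sphereInv.comp OnePoint.continuous_coe) sphereInv_zero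
      fun r => holomorphicToSphereOn_sphereInv_comp isOpen_ball (hlin 0 r)
  | coe z =>
    exact key (fun w => w) z OnePoint.isOpenMap_coe OnePoint.continuous_coe rfl
      fun r => holomorphicToSphereOn_coe_comp isOpen_ball (hlin z r)

theorem DiscChain.length_nonneg {X : Set RiemannSphere} {x y : RiemannSphere} {L : ℝ}
    (h : DiscChain X x y L) : 0 ≤ L := by
  induction h with
  | refl => exact le_rfl
  | step _ f a b _ _ ha hb _ _ ih =>
    exact add_nonneg ih (poincareDist_nonneg (by simpa using ha) (by simpa using hb))

theorem kobayashiDist_nonneg (X : Set RiemannSphere) (x y : RiemannSphere) :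
    0 ≤ kobayashiDist X x y :=
  Real.sInf_nonneg fun _ h => DiscChain.length_nonneg h

theorem kobayashiDist_le {X : Set RiemannSphere} {x y : RiemannSphere} {L : ℝ}
    (h : DiscChain X x y L) : kobayashiDist X x y ≤ L :=
  csInf_le ⟨0, fun _ h => DiscChain.length_nonneg h⟩ h

/-- Near every point of an open set, chains can be prolonged, in both directions, at arbitrarily
small cost. -/
theorem eventually_discChain {X : Set RiemannSphere} (hX : IsOpen X) {y : RiemannSphere}
    (hy : y ∈ X) {δ : ℝ} (hδ : 0 < δ) (hδ1 : δ < 1) :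
    ∀ᶠ z in 𝓝 y, ∀ x, (∀ L, DiscChain X x y L → ∃ L' ≤ L + sigma δ, DiscChain X x z L') ∧
      (∀ L, DiscChain X x z L → ∃ L' ≤ L + sigma δ, DiscChain X x y L') := by
  obtain ⟨φ, hφ, hm, h0, hn⟩ := exists_disc hX hy
  filter_upwards [hn δ hδ]
  rintro _ ⟨w, hw, rfl⟩ x
  have hw' : ‖w‖ < δ := by simpa using hw
  have hw1 : w ∈ ball (0 : ℂ) 1 := by simpa using hw'.trans hδ1
  have h01 : (0 : ℂ) ∈ ball (0 : ℂ) 1 := by simp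
  have hd : poincareDist 0 w ≤ sigma δ := by
    rw [poincareDist_eq, discAut_zero_left]
    exact sigma_mono (norm_nonneg _) hw'.le hδ1
  refine ⟨fun L h => ⟨_, ?_, h.step φ 0 w hφ hm h01 hw1 h0 rfl⟩,
    fun L h => ⟨_, ?_, h.step φ w 0 hφ hm hw1 h01 rfl h0⟩⟩
  · linarith
  · rw [poincareDist_comm w 0]
    linarith

/-- Being reachable by a chain is an open and closed condition by `eventually_discChain`, so
connectedness propagates it. -/
theorem exists_discChain {X : Set RiemannSphere} (hX : IsOpen X) (hc : IsPreconnected X)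
    {x y : RiemannSphere} (hx : x ∈ X) (hy : y ∈ X) : ∃ L, DiscChain X x y L := by
  refine hc.induction₂' (fun y z => ∀ x, (∃ L, DiscChain X x y L) → ∃ L, DiscChain X x z L)
    (fun y hy => ?_) (fun _ _ _ _ _ _ h1 h2 x h => h2 x (h1 x h)) hx hy x ⟨0, .refl x hx⟩
  filter_upwards [mem_nhdsWithin_of_mem_nhds
    (eventually_discChain hX hy (δ := 1 / 2) (by norm_num) (by norm_num))] with z hz
  refine ⟨fun x ⟨L, hL⟩ => ?_, fun x ⟨L, hL⟩ => ?_⟩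
  · obtain ⟨L', -, h⟩ := (hz x).1 L hL
    exact ⟨L', h⟩
  · obtain ⟨L', -, h⟩ := (hz x).2 L hL
    exact ⟨L', h⟩

theorem exists_discChain_le_of_isCompact {X K : Set RiemannSphere} (hX : IsOpen X)
    (hc : IsPreconnected X) (hK : IsCompact K) (hKX : K ⊆ X) {x : RiemannSphere} (hx : x ∈ X) :
    ∃ M, ∀ y ∈ K, ∃ L ≤ M, DiscChain X x y L := by
  refine hK.induction_on (p := fun K => ∃ M, ∀ y ∈ K, ∃ L ≤ M, DiscChain X x y L) ⟨0, by simp⟩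
    (fun s t hst ⟨M, hM⟩ => ⟨M, fun y hy => hM y (hst hy)⟩) ?_ ?_
  · rintro s t ⟨M, hM⟩ ⟨N, hN⟩
    refine ⟨max M N, ?_⟩
    rintro y (hy | hy)
    · obtain ⟨L, hL, h⟩ := hM y hy
      exact ⟨L, hL.trans (le_max_left _ _), h⟩
    · obtain ⟨L, hL, h⟩ := hN y hy
      exact ⟨L, hL.trans (le_max_right _ _), h⟩
  · intro y hy
    obtain ⟨L, hL⟩ := exists_discChain hX hc hx (hKX hy)
    refine ⟨_, mem_nhdsWithin_of_mem_nhds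
      (eventually_discChain hX (hKX hy) (δ := 1 / 2) (by norm_num) (by norm_num)),
      L + sigma (1 / 2), fun z hz => ?_⟩
    exact (hz x).1 L hL

/-- Complex differentiability of a function on the sphere at the points of `X`, in terms of the
two standard charts. -/
def DifferentiableOnSphere (F : RiemannSphere → ℂ) (X : Set RiemannSphere) : Prop :=
  (∀ z : ℂ, (z : RiemannSphere) ∈ X → DifferentiableAt ℂ (fun w : ℂ => F w) z) ∧
    (OnePoint.infty ∈ X → DifferentiableAt ℂ (fun w : ℂ => F (sphereInv w)) 0)

theorem DifferentiableOnSphere.comp {F : RiemannSphere → ℂ} {X : Set RiemannSphere}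
    {φ : ℂ → RiemannSphere} {U : Set ℂ} (hF : DifferentiableOnSphere F X)
    (hφ : HolomorphicToSphereOn φ U) (hU : IsOpen U) (hm : MapsTo φ U X) :
    DifferentiableOn ℂ (F ∘ φ) U := by
  intro z hz
  refine DifferentiableAt.differentiableWithinAt ?_
  have hc := hφ.1.continuousAt (hU.mem_nhds hz)
  by_cases h : φ z = OnePoint.infty
  · have h0 : φ z ≠ ((0 : ℂ) : RiemannSphere) := by simp [h]
    have h1 : DifferentiableAt ℂ (fun w : ℂ => F (sphereInv w)) (inverseCoord (φ z)) := by
      rw [h]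
      exact hF.2 (h ▸ hm hz)
    refine (h1.comp z ((hφ.2 z hz).2 h0)).congr_of_eventuallyEq ?_
    filter_upwards [hc.eventually_ne h0] with w hw
    simp [sphereInv_coe_inverseCoord hw]
  · have h1 : DifferentiableAt ℂ (fun w : ℂ => F w) (affineCoord (φ z)) :=
      hF.1 _ (by rw [coe_affineCoord h]; exact hm hz)
    refine (h1.comp z ((hφ.2 z hz).1 h)).congr_of_eventuallyEq ?_
    filter_upwards [hc.eventually_ne h] with w hw
    simp [coe_affineCoord hw]

/-- Schwarz–Pick applies to the composite of `F` with each disc of the chain, and the triangle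
inequality adds up the links. -/
theorem DiscChain.poincareDist_le {F : RiemannSphere → ℂ} {X : Set RiemannSphere}
    (hF : DifferentiableOnSphere F X) (hFm : MapsTo F X (ball 0 1)) {x y : RiemannSphere} {L : ℝ}
    (h : DiscChain X x y L) : poincareDist (F x) (F y) ≤ L := by
  have key : x ∈ X ∧ y ∈ X ∧ poincareDist (F x) (F y) ≤ L := by
    induction h with
    | refl hx => exact ⟨hx, hx, by simp [poincareDist, sigma]⟩
    | step h f a b hf hX ha hb hfa hfb ih =>
      obtain ⟨hx, hy, hL⟩ := ih
      subst hfa hfb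
      have hn : ∀ {x}, x ∈ X → ‖F x‖ < 1 := fun hx => by simpa using hFm hx
      refine ⟨hx, hX hb, (poincareDist_triangle (hn hx) (hn hy) (hn (hX hb))).trans
        (add_le_add hL ?_)⟩
      exact poincareDist_map_le (hF.comp hf isOpen_ball hX) (hFm.comp hX) (by simpa using ha)
        (by simpa using hb)
  exact key.2.2

theorem differentiableOnSphere_affineCoord_comp {f : ℂ → ℂ} {U : Set ℂ} (hU : IsOpen U)
    (hf : DifferentiableOn ℂ f U) :
    DifferentiableOnSphere (fun x => f (affineCoord x)) (toSphere U) :=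
  ⟨fun _ hz => hf.differentiableAt (hU.mem_nhds (coe_mem_toSphere.1 hz)), fun h => by simp at h⟩

/-! ### Plane domains with connected complement in the sphere -/

/-- The function `z ↦ z - w` for finite `w`, and `1` for `w = ∞`. -/
noncomputable def subFactor (w : RiemannSphere) (z : ℂ) : ℂ := w.elim 1 fun w => z - w

theorem exists_sq_eq_one_add {V : Set ℂ} {u : ℂ → ℂ} (hu : DifferentiableOn ℂ u V)
    (h1 : ∀ z ∈ V, ‖u z‖ < 1) :
    ∃ s : ℂ → ℂ, DifferentiableOn ℂ s V ∧ (∀ z ∈ V, s z ≠ 0) ∧ ∀ z ∈ V, s z ^ 2 = 1 + u z := by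
  have hs : ∀ z ∈ V, 1 + u z ∈ Complex.slitPlane := fun z hz =>
    Complex.mem_slitPlane_of_norm_lt_one (h1 z hz)
  refine ⟨fun z => Complex.exp (Complex.log (1 + u z) / 2), ?_, fun _ _ => Complex.exp_ne_zero _,
    fun z hz => ?_⟩
  · exact (((hu.const_add 1).clog hs).div_const 2).cexp
  · rw [← Complex.exp_nat_mul, Nat.cast_ofNat, mul_div_cancel₀ _ two_ne_zero,
      Complex.exp_log (Complex.slitPlane_ne_zero (hs z hz))]

/-- The quotient of the two factors is a nonzero constant times `1 + u` with `‖u‖ < 1`, so it has a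
root. For finite `w` it is `1 + (w - w') / (z - w)`; near `∞` it is `-w' * (1 - z / w')`, which is
where boundedness of `V` enters. -/
theorem exists_sq_mul_subFactor {V : Set ℂ} {R ε : ℝ} (hε : 0 < ε) (hVR : ∀ z ∈ V, ‖z‖ < R)
    (w : RiemannSphere) : ∀ᶠ w' in 𝓝 w, (∀ v : ℂ, w = v → ∀ z ∈ V, ε ≤ dist z v) →
      ∃ s : ℂ → ℂ, DifferentiableOn ℂ s V ∧ (∀ z ∈ V, s z ≠ 0) ∧
        ∀ z ∈ V, subFactor w' z = s z ^ 2 * subFactor w z := by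
  induction w using OnePoint.rec with
  | infty =>
    rw [OnePoint.nhds_infty_eq, eventually_sup, eventually_map, eventually_pure]
    refine ⟨?_, fun _ => ⟨1, differentiableOn_const _, by simp, by simp⟩⟩
    rw [Filter.coclosedCompact_eq_cocompact, ← Metric.cobounded_eq_cocompact]
    filter_upwards [(tendsto_norm_cobounded_atTop (E := ℂ)).eventually_gt_atTop (max R 0)]
      with w hw _
    have hw0 : w ≠ 0 := norm_pos_iff.1 ((le_max_right _ _).trans_lt hw)
    obtain ⟨s, hs, hs0, hs2⟩ := exists_sq_eq_one_add (V := V) (u := fun z => -(z / w))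
      (by fun_prop) (fun z hz => by
        rw [norm_neg, norm_div, div_lt_one (norm_pos_iff.2 hw0)]
        exact (hVR z hz).trans ((le_max_left _ _).trans_lt hw))
    obtain ⟨t, ht⟩ := IsSquare.exists_sq (-w) (Complex.isSquare _)
    have ht0 : t ≠ 0 := by
      rintro rfl
      simp [hw0] at ht
    refine ⟨fun z => t * s z, hs.const_mul t, fun z hz => mul_ne_zero ht0 (hs0 z hz),
      fun z hz => ?_⟩
    rw [mul_pow, hs2 z hz, ← ht]
    simp [subFactor]
    field_simp
    ring
  | coe w =>
    rw [OnePoint.nhds_coe_eq, eventually_map]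
    filter_upwards [ball_mem_nhds w hε] with w' hw' hV
    replace hV := hV w rfl
    have h0 : ∀ z ∈ V, z - w ≠ 0 := fun z hz h => by
      have := hV z hz
      rw [dist_eq_norm, h, norm_zero] at this
      linarith
    obtain ⟨s, hs, hs0, hs2⟩ := exists_sq_eq_one_add (V := V) (u := fun z => (w - w') / (z - w))
      ((differentiableOn_const _).div (differentiableOn_id.sub_const w) h0) (fun z hz => by
        rw [norm_div, div_lt_one (norm_pos_iff.2 (h0 z hz)), ← dist_eq_norm, ← dist_eq_norm]
        rw [mem_ball, dist_comm] at hw'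
        exact hw'.trans_le (hV z hz))
    refine ⟨s, hs, hs0, fun z hz => ?_⟩
    have := h0 z hz
    rw [hs2 z hz]
    simp [subFactor]
    field_simp
    ring

/-- Solvability of `k ^ 2 = (z - c) * subFactor w z` is locally constant in `w` on the complement.
It holds at `w = c`, where the right-hand side is a square, and connectedness carries it to `w = ∞`,
where the factor is `1`. -/
theorem exists_sq_eq_sub_of_bounded {U V : Set ℂ} (hE : IsPreconnected (toSphere U)ᶜ)
    {c : ℂ} (hc : c ∉ U) {R ε : ℝ} (hε : 0 < ε) (hVR : ∀ z ∈ V, ‖z‖ < R)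
    (hV : ∀ z ∈ V, ∀ w ∉ U, ε ≤ dist z w) :
    ∃ k : ℂ → ℂ, DifferentiableOn ℂ k V ∧ ∀ z ∈ V, k z ^ 2 = z - c := by
  let P : RiemannSphere → Prop := fun w =>
    ∃ k : ℂ → ℂ, DifferentiableOn ℂ k V ∧ ∀ z ∈ V, k z ^ 2 = (z - c) * subFactor w z
  have hloc : ∀ w ∈ (toSphere U)ᶜ, ∀ᶠ w' in 𝓝[(toSphere U)ᶜ] w, (P w → P w') ∧ (P w' → P w) := by
    intro w hw
    filter_upwards [mem_nhdsWithin_of_mem_nhds (exists_sq_mul_subFactor hε hVR w)] with w' hw'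
    obtain ⟨s, hs, hs0, hs2⟩ := hw' (fun v hv z hz => hV z hz v fun h => hw (by simpa [hv] using h))
    refine ⟨fun ⟨k, hk, hk2⟩ => ⟨fun z => k z * s z, hk.mul hs, fun z hz => ?_⟩,
      fun ⟨k, hk, hk2⟩ => ⟨fun z => k z / s z, hk.div hs hs0, fun z hz => ?_⟩⟩
    · rw [mul_pow, hk2 z hz, hs2 z hz]
      ring
    · have := hs0 z hz
      rw [div_pow, hk2 z hz, hs2 z hz]
      field_simp
  have hP : P OnePoint.infty := by
    refine hE.induction₂' (fun w w' => P w → P w') hloc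
      (fun _ _ _ _ _ _ h1 h2 h => h2 (h1 h)) (x := (c : RiemannSphere)) (by simpa using hc)
      (by simp) ⟨fun z => z - c, by fun_prop, fun z _ => ?_⟩
    simp [subFactor, sq]
  obtain ⟨k, hk, hk2⟩ := hP
  exact ⟨k, hk, fun z hz => by simpa [subFactor] using hk2 z hz⟩

/-- On a plane domain with connected complement in the sphere, `z - c` has a holomorphic square
root for every `c` outside of the domain. -/
theorem exists_sq_eq_sub {U : Set ℂ} (hU : IsOpen U) (hUc : IsConnected U)
    (hE : IsPreconnected (toSphere U)ᶜ) {c : ℂ} (hc : c ∉ U) :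
    ∃ h : ℂ → ℂ, DifferentiableOn ℂ h U ∧ ∀ z ∈ U, h z ^ 2 = z - c := by
  classical
  obtain ⟨z₀, hz₀⟩ := hUc.nonempty
  have hne : (Uᶜ).Nonempty := ⟨c, hc⟩
  -- Exhaustion of `U` by bounded sets at positive distance from the complement. Passing to the
  -- components through `z₀` makes a root unique once its value at `z₀` is fixed, so the roots on
  -- different levels agree.
  let W : ℕ → Set ℂ := fun n => {z | ‖z‖ < n + 1 ∧ ((n : ℝ) + 1)⁻¹ < infDist z Uᶜ}
  let V : ℕ → Set ℂ := fun n => connectedComponentIn (W n) z₀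
  have hWo : ∀ n, IsOpen (W n) := fun n =>
    (isOpen_lt continuous_norm continuous_const).inter
      (isOpen_lt continuous_const (continuous_infDist_pt _))
  have hWm : Monotone W := by
    intro m n hmn z hz
    have : (m : ℝ) ≤ n := by exact_mod_cast hmn
    refine ⟨hz.1.trans_le (by linarith), lt_of_le_of_lt ?_ hz.2⟩
    gcongr
  have hWU : ∀ z ∈ U, ∃ n, z ∈ W n := by
    intro z hz
    have hp : 0 < infDist z Uᶜ :=
      (hU.isClosed_compl.notMem_iff_infDist_pos hne).1 (by simpa using hz)
    obtain ⟨m, hm⟩ := exists_nat_gt ‖z‖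
    obtain ⟨n, hn⟩ := exists_nat_one_div_lt hp
    rw [one_div] at hn
    refine ⟨max m n, (hm.trans_le ?_), hn.trans_le' ?_⟩
    · exact (Nat.cast_le.2 (le_max_left m n)).trans (by linarith)
    · gcongr
      exact le_max_right m n
  have hWU' : ∀ n, W n ⊆ U := by
    intro n z hz
    by_contra h
    have h2 := hz.2
    rw [infDist_zero_of_mem (by exact h)] at h2
    have : (0 : ℝ) < ((n : ℝ) + 1)⁻¹ := by positivity
    linarith
  have hVo : ∀ n, IsOpen (V n) := fun n => (hWo n).connectedComponentIn
  have hVm : Monotone V := fun m n hmn => connectedComponentIn_mono _ (hWm hmn)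
  have hVW : ∀ n, V n ⊆ W n := fun n => connectedComponentIn_subset _ _
  have hz₀V : ∀ n z, z ∈ V n → z₀ ∈ V n := fun n z hz =>
    mem_connectedComponentIn (mem_of_mem_of_subset (connectedComponentIn_nonempty_iff.1 ⟨z, hz⟩)
      Subset.rfl)
  have hVU : ∀ z ∈ U, ∃ n, z ∈ V n := by
    intro z hz
    obtain ⟨γ, hγ⟩ := (hU.isConnected_iff_isPathConnected.1 hUc).joinedIn z₀ hz₀ z hz
    obtain ⟨n, hn⟩ := (isCompact_range γ.continuous).elim_directed_cover W hWo
      (by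
        rintro _ ⟨t, rfl⟩
        exact mem_iUnion.2 (hWU _ (hγ t))) hWm.directed_le
    refine ⟨n, (isPreconnected_range γ.continuous).subset_connectedComponentIn
      ⟨0, γ.source⟩ hn ⟨1, γ.target⟩⟩
  obtain ⟨s₀, hs₀⟩ := IsSquare.exists_sq (z₀ - c) (Complex.isSquare _)
  have hk : ∀ n, ∃ k : ℂ → ℂ, DifferentiableOn ℂ k (V n) ∧ (∀ z ∈ V n, k z ^ 2 = z - c) ∧
      (z₀ ∈ V n → k z₀ = s₀) := by
    intro n
    obtain ⟨k, hk, hk2⟩ := exists_sq_eq_sub_of_bounded (V := V n) hE hc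
      (inv_pos.2 (Nat.cast_add_one_pos n)) (fun z hz => (hVW n hz).1)
      (fun z hz w hw => (hVW n hz).2.le.trans (infDist_le_dist_of_mem hw))
    by_cases h : z₀ ∈ V n
    · have : k z₀ = s₀ ∨ k z₀ = -s₀ := sq_eq_sq_iff_eq_or_eq_neg.1 ((hk2 _ h).trans hs₀)
      rcases this with h1 | h1
      · exact ⟨k, hk, hk2, fun _ => h1⟩
      · exact ⟨fun z => -k z, hk.neg, fun z hz => by rw [neg_sq, hk2 z hz],
          fun _ => by simp [h1]⟩
    · exact ⟨k, hk, hk2, fun h' => absurd h' h⟩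
  choose k hk hk2 hk0 using hk
  have hagree : ∀ m n, m ≤ n → ∀ z ∈ V m, k m z = k n z := by
    intro m n hmn z hz
    have h0 := hz₀V m z hz
    refine isPreconnected_connectedComponentIn.eq_of_sq_eq (hk m).continuousOn
      ((hk n).continuousOn.mono (hVm hmn)) (fun w hw => ?_) (fun {w} hw h => ?_) h0 ?_ hz
    · simp only [Pi.pow_apply]
      rw [hk2 m w hw, hk2 n w (hVm hmn hw)]
    · have := hk2 n w (hVm hmn hw)
      rw [h, zero_pow two_ne_zero, eq_comm, sub_eq_zero] at this
      exact hc (this ▸ hWU' m (hVW m hw))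
    · rw [hk0 m h0, hk0 n (hVm hmn h0)]
  let h : ℂ → ℂ := fun z => if hz : ∃ n, z ∈ V n then k (Nat.find hz) z else 0
  have hh : ∀ n, ∀ z ∈ V n, h z = k n z := by
    intro n z hz
    have hz' : ∃ n, z ∈ V n := ⟨n, hz⟩
    simp only [h, dif_pos hz']
    exact hagree _ _ (Nat.find_min' hz' hz) z (Nat.find_spec hz')
  refine ⟨h, fun z hz => ?_, fun z hz => ?_⟩
  · obtain ⟨n, hn⟩ := hVU z hz
    have hnhds := (hVo n).mem_nhds hn
    refine (((hk n).differentiableAt hnhds).congr_of_eventuallyEq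
      ?_).differentiableWithinAt
    filter_upwards [hnhds] with w hw using hh n w hw
  · obtain ⟨n, hn⟩ := hVU z hz
    rw [hh n z hn, hk2 n z hn]

/-! ### Connectedness of the complement under Möbius maps and square roots. -/

theorem compl_toSphere_image {U : Set ℂ} {μ : ℂ → ℂ} (m : RiemannSphere ≃ₜ RiemannSphere)
    (hm : ∀ z ∈ U, m z = μ z) : (toSphere (μ '' U))ᶜ = m '' (toSphere U)ᶜ := by
  rw [image_compl_eq m.bijective, toSphere, toSphere, image_image, image_image]
  congr 1
  exact image_congr fun z hz => (hm z hz).symm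

theorem isPreconnected_compl_toSphere_image {U : Set ℂ} {μ : ℂ → ℂ}
    (m : RiemannSphere ≃ₜ RiemannSphere) (hm : ∀ z ∈ U, m z = μ z)
    (hE : IsPreconnected (toSphere U)ᶜ) : IsPreconnected (toSphere (μ '' U))ᶜ := by
  rw [compl_toSphere_image m hm]
  exact hE.image _ m.continuous.continuousOn

/-- The Möbius transformation `z ↦ b / (z - c) + a` of the sphere. -/
noncomputable def sphereMoebius (a b c : ℂ) (hb : b ≠ 0) : RiemannSphere ≃ₜ RiemannSphere :=
  ((Homeomorph.subRight c).onePointCongr.trans sphereInvHomeo).trans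
    ((Homeomorph.mulLeft₀ b hb).trans (Homeomorph.addRight a)).onePointCongr

theorem sphereMoebius_coe {a b c : ℂ} (hb : b ≠ 0) {z : ℂ} (hz : z ≠ c) :
    sphereMoebius a b c hb (z : RiemannSphere) = ((b / (z - c) + a : ℂ) : RiemannSphere) := by
  have h : sphereInvHomeo ((z - c : ℂ) : RiemannSphere) = (((z - c)⁻¹ : ℂ) : RiemannSphere) :=
    sphereInv_coe (sub_ne_zero.2 hz)
  change (((Homeomorph.mulLeft₀ b hb).trans (Homeomorph.addRight a)).onePointCongr)
    (sphereInvHomeo ((z - c : ℂ) : RiemannSphere)) = _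
  rw [h, div_eq_mul_inv]
  rfl

theorem sphereMoebius_self {a b c : ℂ} (hb : b ≠ 0) :
    sphereMoebius a b c hb (c : RiemannSphere) = OnePoint.infty := by
  change (((Homeomorph.mulLeft₀ b hb).trans (Homeomorph.addRight a)).onePointCongr)
    (sphereInv ((c - c : ℂ) : RiemannSphere)) = _
  rw [sub_self, sphereInv_zero]
  rfl

theorem isPreconnected_compl_toSphere_discAut_image {U : Set ℂ} (hU : U ⊆ ball 0 1)
    (hE : IsPreconnected (toSphere U)ᶜ) {c : ℂ} (hc : ‖c‖ < 1) :
    IsPreconnected (toSphere (discAut c '' U))ᶜ := by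
  by_cases h0 : c = 0
  · subst h0
    have : discAut 0 = id := funext discAut_zero_left
    simpa [this] using hE
  have hc0 : (starRingEnd ℂ) c ≠ 0 := by simpa using h0
  have hcc := one_sub_conj_mul_ne_zero hc hc
  -- Partial fractions: `discAut c` has its pole at `1 / conj c`, the value `-1 / conj c` at `∞`,
  -- and this residue.
  have hb : -(1 - (starRingEnd ℂ) c * c) / ((starRingEnd ℂ) c) ^ 2 ≠ 0 :=
    div_ne_zero (neg_ne_zero.2 hcc) (pow_ne_zero 2 hc0)
  refine isPreconnected_compl_toSphere_image
    (sphereMoebius (-1 / (starRingEnd ℂ) c) _ (1 / (starRingEnd ℂ) c) hb) (fun z hz => ?_) hE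
  have hz1 : 1 - (starRingEnd ℂ) c * z ≠ 0 :=
    one_sub_conj_mul_ne_zero hc (by simpa using hU hz)
  have hz2 : z ≠ 1 / (starRingEnd ℂ) c := by
    rintro rfl
    apply hz1
    field_simp
    ring
  rw [sphereMoebius_coe hb hz2, discAut]
  congr 1
  have hz3 : (starRingEnd ℂ) c * z - 1 ≠ 0 := by
    rw [← neg_sub]
    exact neg_ne_zero.2 hz1
  have hz4 : z - 1 / (starRingEnd ℂ) c = -(1 - (starRingEnd ℂ) c * z) / (starRingEnd ℂ) c := by
    field_simp
    ring
  rw [hz4]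
  generalize hd : 1 - (starRingEnd ℂ) c * z = d at *
  field_simp
  linear_combination hd

/-- The map `w ↦ w ^ 2 + c` of the sphere. -/
noncomputable def sphereSq (c : ℂ) : RiemannSphere → RiemannSphere :=
  OnePoint.map fun w => w ^ 2 + c

/-- The map `w ↦ -w` of the sphere. -/
noncomputable def sphereNeg : RiemannSphere → RiemannSphere := OnePoint.map fun w => -w

theorem continuous_sphereSq (c : ℂ) : Continuous (sphereSq c) := by
  refine OnePoint.continuous_map (by fun_prop) ?_
  rw [Filter.coclosedCompact_eq_cocompact, ← Metric.cobounded_eq_cocompact]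
  exact (Homeomorph.addRight c).isClosedEmbedding.tendsto_cocompact |> fun h => by
    rw [← Metric.cobounded_eq_cocompact] at h
    exact h.comp (tendsto_pow_cobounded_cobounded two_ne_zero)

theorem continuous_sphereNeg : Continuous sphereNeg :=
  (Homeomorph.neg ℂ).onePointCongr.continuous

theorem sphereNeg_sphereNeg (x : RiemannSphere) : sphereNeg (sphereNeg x) = x := by
  induction x using OnePoint.rec <;> simp [sphereNeg]

theorem sphereSq_sphereNeg (c : ℂ) (x : RiemannSphere) :
    sphereSq c (sphereNeg x) = sphereSq c x := by
  induction x using OnePoint.rec <;> simp [sphereNeg, sphereSq]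

theorem sphereSq_eq_iff {c : ℂ} {x y : RiemannSphere} (h : sphereSq c x = sphereSq c y) :
    y = x ∨ y = sphereNeg x := by
  induction x using OnePoint.rec with
  | infty =>
    induction y using OnePoint.rec with
    | infty => exact Or.inl rfl
    | coe y => simp [sphereSq] at h
  | coe x =>
    induction y using OnePoint.rec with
    | infty => simp [sphereSq] at h
    | coe y =>
      simp only [sphereSq, sphereNeg, OnePoint.map_some, OnePoint.coe_eq_coe,
        add_left_inj] at h ⊢
      exact sq_eq_sq_iff_eq_or_eq_neg.1 h.symm

theorem surjective_sphereSq (c : ℂ) : Function.Surjective (sphereSq c) := by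
  intro x
  induction x using OnePoint.rec with
  | infty => exact ⟨OnePoint.infty, rfl⟩
  | coe x =>
    obtain ⟨s, hs⟩ := IsSquare.exists_sq (x - c) (Complex.isSquare _)
    refine ⟨(s : RiemannSphere), ?_⟩
    simp [sphereSq, ← hs]

/-- The fibres of `sphereSq` are the pairs `{x, -x}`, and the branch point `∞` ties the two sheets
together. If the preimage split into closed parts `t ∋ ∞` and `t'`, then `E` would be covered by two
closed nonempty sets: values of points with both `x` and `-x` in `t`, and values of points with one
of the two in `t'`. Connectedness gives a common value, and its fibre would meet `t ∩ t'`. -/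
theorem isPreconnected_sphereSq_preimage {c : ℂ} {E : Set RiemannSphere} (hEc : IsClosed E)
    (hE : IsPreconnected E) (hi : OnePoint.infty ∈ E) : IsPreconnected (sphereSq c ⁻¹' E) := by
  set s := sphereSq c ⁻¹' E with hs
  have hsc : IsClosed s := hEc.preimage (continuous_sphereSq c)
  have hsn : ∀ x, sphereNeg x ∈ s ↔ x ∈ s := fun x => by
    simp only [hs, mem_preimage, sphereSq_sphereNeg]
  have key : ∀ t t' : Set RiemannSphere, IsClosed t → IsClosed t' → s ⊆ t ∪ t' →
      (s ∩ t').Nonempty → OnePoint.infty ∈ t → (s ∩ (t ∩ t')).Nonempty := by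
    intro t t' ht ht' hst hne hit
    by_contra hempty
    rw [not_nonempty_iff_eq_empty, eq_empty_iff_forall_notMem] at hempty
    have hA : IsClosed (s ∩ (t ∩ sphereNeg ⁻¹' t)) :=
      hsc.inter (ht.inter (ht.preimage continuous_sphereNeg))
    have hB : IsClosed (s ∩ (t' ∪ sphereNeg ⁻¹' t')) :=
      hsc.inter (ht'.union (ht'.preimage continuous_sphereNeg))
    have hA' := (hA.isCompact.image (continuous_sphereSq c)).isClosed
    have hB' := (hB.isCompact.image (continuous_sphereSq c)).isClosed
    obtain ⟨e, -, ⟨a, ⟨has, ha, ha'⟩, rfl⟩, b, ⟨hbs, hb⟩, hab⟩ :=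
      isPreconnected_closed_iff.1 hE _ _ hA' hB' (by
        intro e he
        obtain ⟨x, rfl⟩ := surjective_sphereSq c e
        have hxs : x ∈ s := he
        by_cases hx : x ∈ t' ∪ sphereNeg ⁻¹' t'
        · exact Or.inr ⟨x, ⟨hxs, hx⟩, rfl⟩
        · rw [mem_union, not_or] at hx
          exact Or.inl ⟨x, ⟨hxs, (hst hxs).resolve_right hx.1,
            (hst ((hsn x).2 hxs)).resolve_right hx.2⟩, rfl⟩)
        ⟨OnePoint.infty, hi, OnePoint.infty, ⟨hi, hit, hit⟩, rfl⟩
        (by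
          obtain ⟨x, hx, hx'⟩ := hne
          exact ⟨sphereSq c x, hx, x, ⟨hx, Or.inl hx'⟩, rfl⟩)
    have hfin : ∀ x ∈ s, x ∈ t → sphereNeg x ∈ t → (x ∈ t' ∨ sphereNeg x ∈ t') → False := by
      rintro x hx h1 h2 (h3 | h3)
      · exact hempty x ⟨hx, h1, h3⟩
      · exact hempty _ ⟨(hsn x).2 hx, h2, h3⟩
    rcases sphereSq_eq_iff hab with h | h
    · exact hfin b hbs (h ▸ ha) (h ▸ ha') hb
    · subst h
      exact hfin b hbs (by simpa [sphereNeg_sphereNeg] using ha') ha hb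
  rw [isPreconnected_closed_iff]
  intro t t' ht ht' hst h1 h2
  have his : OnePoint.infty ∈ s := hi
  rcases hst his with h | h
  · exact key t t' ht ht' hst h2 h
  · rw [inter_comm t t']
    exact key t' t ht' ht (by rwa [union_comm]) h1 h

/-- The image of a plane domain with connected complement under a branch of `√(z - c)` has
connected complement. -/
theorem isPreconnected_compl_toSphere_sqrt_image {U : Set ℂ} (hU : IsOpen U) (hUc : IsConnected U)
    (hE : IsPreconnected (toSphere U)ᶜ) {c : ℂ} (hc : c ∉ U) {h : ℂ → ℂ}
    (hd : DifferentiableOn ℂ h U) (hsq : ∀ z ∈ U, h z ^ 2 = z - c) :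
    IsPreconnected (toSphere (h '' U))ᶜ := by
  have hinj : InjOn h U := fun x hx y hy hxy => by
    have := hsq x hx
    rw [hxy, hsq y hy] at this
    linear_combination -this
  have hopen := isOpen_image_of_injOn hU hd hinj hU Subset.rfl
  set T := toSphere ((fun z => -h z) '' U) with hT
  have hTc : IsConnected T := isConnected_toSphere (hUc.image _ hd.neg.continuousOn)
  have hTo : IsOpen T := by
    refine isOpen_toSphere ?_
    have := (Homeomorph.neg ℂ).isOpenMap _ hopen
    rwa [image_image] at this
  have h0 : ∀ z ∈ U, h z ≠ 0 := fun z hz h0 => by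
    have := hsq z hz
    rw [h0, zero_pow two_ne_zero, eq_comm, sub_eq_zero] at this
    exact hc (this ▸ hz)
  have hdisj : ∀ w, w ∈ h '' U → (w : RiemannSphere) ∉ T := by
    rintro _ ⟨z, hz, rfl⟩ hw
    obtain ⟨z', hz', h'⟩ := coe_mem_toSphere.1 hw
    have h'' : -h z' = h z := h'
    have h1 : z' = z := by
      have := hsq z hz
      rw [← h'', neg_sq, hsq z' hz'] at this
      linear_combination this
    subst h1
    exact h0 z' hz' (by linear_combination (-1 / 2 : ℂ) * h'')
  -- The points lying over `U` are `h z` and `-h z`. Removing the first branch leaves the preimage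
  -- of the complement together with the second branch `T`.
  have hcompl : (toSphere (h '' U))ᶜ = sphereSq c ⁻¹' (toSphere U)ᶜ ∪ T := by
    ext x
    induction x using OnePoint.rec with
    | infty => simp [sphereSq]
    | coe w =>
      simp only [mem_compl_iff, coe_mem_toSphere, sphereSq, mem_union, mem_preimage,
        OnePoint.map_some, hT]
      constructor
      · intro hw
        by_cases hwU : w ^ 2 + c ∈ U
        · right
          have : w = h (w ^ 2 + c) ∨ w = -h (w ^ 2 + c) :=
            sq_eq_sq_iff_eq_or_eq_neg.1 (by rw [hsq _ hwU]; ring)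
          rcases this with h1 | h1
          · exact absurd ⟨_, hwU, h1.symm⟩ hw
          · exact ⟨_, hwU, h1.symm⟩
        · exact Or.inl hwU
      · rintro (hw | hw) hw'
        · obtain ⟨z, hz, rfl⟩ := hw'
          rw [hsq z hz, sub_add_cancel] at hw
          exact hw hz
        · exact hdisj w hw' (coe_mem_toSphere.2 hw)
  -- `T` is open and misses `∞`, so it is not closed in the connected sphere. A limit point outside
  -- `T` lies in the preimage of the complement and glues the two pieces together.
  obtain ⟨x, hxT, hxn⟩ : ∃ x ∈ closure T, x ∉ T := by
    by_contra! hcon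
    have hcl : IsClosed T := closure_subset_iff_isClosed.1 hcon
    have := IsClopen.eq_univ ⟨hcl, hTo⟩ hTc.nonempty
    have h1 : OnePoint.infty ∈ T := this ▸ mem_univ _
    exact infty_notMem_toSphere h1
  have hxE : x ∈ sphereSq c ⁻¹' (toSphere U)ᶜ := by
    have hx1 : x ∈ (toSphere (h '' U))ᶜ := by
      intro hx
      obtain ⟨y, hy1, hy2⟩ := mem_closure_iff.1 hxT _ (isOpen_toSphere hopen) hx
      obtain ⟨w, hw, rfl⟩ := hy1
      exact hdisj w hw hy2
    rw [hcompl] at hx1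
    exact hx1.resolve_right hxn
  have h1 : IsPreconnected (insert x T) :=
    hTc.isPreconnected.subset_closure (subset_insert _ _)
      (insert_subset hxT subset_closure)
  have h2 := (isPreconnected_sphereSq_preimage (c := c)
    (isOpen_toSphere hU).isClosed_compl hE (by simp)).union x hxE (mem_insert x T) h1
  rw [hcompl]
  convert h2 using 1
  rw [union_insert, insert_eq_of_mem (mem_union_left _ hxE)]

/-! ### The squeezing property of simply connected domains -/

/-- `f` is a holomorphic embedding of `U` into the unit disc whose image has connected complement
in the sphere. -/
def IsFullDiscEmbedding (U : Set ℂ) (f : ℂ → ℂ) : Prop :=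
  DifferentiableOn ℂ f U ∧ InjOn f U ∧ MapsTo f U (ball 0 1) ∧
    IsPreconnected (toSphere (f '' U))ᶜ

theorem IsFullDiscEmbedding.discAut_comp {U : Set ℂ} {f : ℂ → ℂ} (hf : IsFullDiscEmbedding U f)
    {c : ℂ} (hc : ‖c‖ < 1) : IsFullDiscEmbedding U (discAut c ∘ f) := by
  obtain ⟨hd, hi, hm, hE⟩ := hf
  refine ⟨(differentiableOn_discAut hc).comp hd hm, (injOn_discAut hc).comp hi hm,
    (mapsTo_discAut hc).comp hm, ?_⟩
  rw [image_comp]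
  exact isPreconnected_compl_toSphere_discAut_image hm.image_subset hE hc

/-- A branch `h` of the root and `-h` have disjoint images, so `h` omits a whole disc about `-h z`;
inversion in the centre of that disc makes the image bounded. -/
theorem exists_isFullDiscEmbedding {U : Set ℂ} (hU : IsOpen U) (hUc : IsConnected U)
    (hE : IsPreconnected (toSphere U)ᶜ) {b : ℂ} (hb : b ∉ U) :
    ∃ f, IsFullDiscEmbedding U f := by
  obtain ⟨h, hd, hsq⟩ := exists_sq_eq_sub hU hUc hE hb
  obtain ⟨z, hz⟩ := hUc.nonempty
  have hinj : InjOn h U := fun x hx y hy hxy => by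
    have := hsq x hx
    rw [hxy, hsq y hy] at this
    linear_combination -this
  have hopen := isOpen_image_of_injOn hU hd hinj hU Subset.rfl
  obtain ⟨δ, hδ, hball⟩ := Metric.isOpen_iff.1 hopen (h z) (mem_image_of_mem h hz)
  have hfar : ∀ w ∈ U, δ ≤ ‖h w + h z‖ := by
    intro w hw
    by_contra! hlt
    obtain ⟨w', hw', hww⟩ := hball (show -h w ∈ ball (h z) δ by
      rwa [mem_ball, dist_eq_norm, ← norm_neg, neg_sub, sub_neg_eq_add, add_comm])
    have h1 : w' = w := by
      have := hsq w hw
      rw [← neg_sq, ← hww, hsq w' hw'] at this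
      linear_combination this
    subst h1
    have h2 : h w' = 0 := by linear_combination (1 / 2 : ℂ) * hww
    have h3 := hsq w' hw
    rw [h2, zero_pow two_ne_zero, eq_comm, sub_eq_zero] at h3
    exact hb (h3 ▸ hw)
  have hne : ∀ w ∈ U, h w + h z ≠ 0 := fun w hw h0 => by
    have := hfar w hw
    rw [h0, norm_zero] at this
    linarith
  have hδ' : ((δ / 2 : ℝ) : ℂ) ≠ 0 := by
    norm_cast
    positivity
  refine ⟨fun w => ((δ / 2 : ℝ) : ℂ) / (h w + h z), (differentiableOn_const _).div
    (hd.add_const _) hne, fun x hx y hy hxy => ?_, fun w hw => ?_, ?_⟩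
  · refine hinj hx hy ?_
    have h1 := hne x hx
    have h2 := hne y hy
    simp only at hxy
    rw [div_eq_div_iff h1 h2] at hxy
    have := mul_left_cancel₀ hδ' hxy
    linear_combination -this
  · have h1 := hfar w hw
    rw [mem_ball_zero_iff, norm_div, Complex.norm_real, Real.norm_eq_abs,
      abs_of_pos (half_pos hδ), div_lt_one (hδ.trans_le h1)]
    linarith
  · have h1 := isPreconnected_compl_toSphere_image (U := h '' U)
      (μ := fun w => ((δ / 2 : ℝ) : ℂ) / (w - -h z) + 0) (sphereMoebius 0 _ (-h z) hδ') (by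
        rintro _ ⟨w, hw, rfl⟩
        refine sphereMoebius_coe hδ' fun h1 => hne w hw ?_
        rw [h1]
        ring)
      (isPreconnected_compl_toSphere_sqrt_image hU hUc hE hb hd hsq)
    rw [image_image] at h1
    simpa using h1

/-- The square root trick of Koebe. -/
theorem IsFullDiscEmbedding.exists_deriv_eq {U : Set ℂ} {f : ℂ → ℂ} (hU : IsOpen U)
    (hUc : IsConnected U) (hf : IsFullDiscEmbedding U f) {z : ℂ} (hz : z ∈ U) (hfz : f z = 0)
    {c : ℂ} (hc : c ∉ f '' U) (hc1 : ‖c‖ < 1) :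
    ∃ F, IsFullDiscEmbedding U F ∧ F z = 0 ∧
      ‖deriv F z‖ = (1 + ‖c‖) / (2 * √‖c‖) * ‖deriv f z‖ := by
  have hc0 : c ≠ 0 := by
    rintro rfl
    exact hc ⟨z, hz, hfz⟩
  obtain ⟨hvd, hvi, hvm, hvE⟩ := hf.discAut_comp hc1
  -- Moving the omitted value `c` to `0` makes a square root available; a second automorphism
  -- returns the image of `z` to `0`.
  set v := discAut c ∘ f with hv
  have hvz : v z = -c := by simp [hv, hfz]
  have hVo := isOpen_image_of_injOn hU hvd hvi hU Subset.rfl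
  have hVc : IsConnected (v '' U) := hUc.image _ hvd.continuousOn
  have h0V : (0 : ℂ) ∉ v '' U := by
    rintro ⟨w, hw, h0⟩
    have h1 : f w ∈ ball (0 : ℂ) 1 := hf.2.2.1 hw
    have h2 : c ∈ ball (0 : ℂ) 1 := by simpa using hc1
    exact hc ⟨w, hw, injOn_discAut hc1 h1 h2 (by simpa [hv] using h0)⟩
  obtain ⟨h, hhd, hsq⟩ := exists_sq_eq_sub hVo hVc hvE h0V
  have hhE := isPreconnected_compl_toSphere_sqrt_image hVo hVc hvE h0V hhd hsq
  have hvU : MapsTo v U (v '' U) := mapsTo_image v U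
  have hm : MapsTo (h ∘ v) U (ball 0 1) := by
    intro w hw
    have h1 : ‖v w‖ < 1 := by simpa using hvm hw
    have h2 := hsq _ (hvU hw)
    rw [sub_zero] at h2
    rw [mem_ball_zero_iff]
    rw [← h2, norm_pow] at h1
    exact (sq_lt_one_iff₀ (norm_nonneg _)).1 h1
  have hfull : IsFullDiscEmbedding U (h ∘ v) := by
    refine ⟨hhd.comp hvd hvU, fun x hx y hy hxy => hvi hx hy ?_, hm, by rwa [image_comp]⟩
    have h1 := hsq _ (hvU hx)
    have h2 := hsq _ (hvU hy)
    simp only [Function.comp_apply] at hxy h1 h2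
    rw [hxy, h2] at h1
    linear_combination -h1
  set β := h (v z) with hβ
  have hβ1 : ‖β‖ < 1 := by simpa using hm hz
  have hβ2 : β ^ 2 = -c := by rw [hβ, hsq _ (hvU hz), hvz, sub_zero]
  have hβn : ‖β‖ ^ 2 = ‖c‖ := by rw [← norm_pow, hβ2, norm_neg]
  have hβs : √‖c‖ = ‖β‖ := by rw [← hβn, Real.sqrt_sq (norm_nonneg _)]
  have hβ0 : β ≠ 0 := by
    intro h0
    rw [h0, zero_pow two_ne_zero, eq_comm, neg_eq_zero] at hβ2
    exact hc0 hβ2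
  refine ⟨discAut β ∘ (h ∘ v), hfull.discAut_comp hβ1, by simp [hβ], ?_⟩
  have hdf := (hf.1.differentiableAt (hU.mem_nhds hz)).hasDerivAt
  have hdv : HasDerivAt v ((1 - (‖c‖ : ℂ) ^ 2) * deriv f z) z := by
    have h1 := hasDerivAt_discAut hc1 (w := f z) (by simp [hfz])
    exact (h1.comp z hdf).congr_deriv (by simp [hfz])
  have hdh := (hhd.differentiableAt (hVo.mem_nhds (hvU hz))).hasDerivAt
  have hdh' : 2 * β * deriv h (v z) = 1 := by
    have h1 : HasDerivAt (fun w : ℂ => w) (2 * β * deriv h (v z)) (v z) := by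
      refine ((hdh.pow 2).congr_deriv (by simp [hβ])).congr_of_eventuallyEq ?_
      filter_upwards [hVo.mem_nhds (hvU hz)] with w hw
      simpa using (hsq w hw).symm
    exact h1.unique (hasDerivAt_id' _)
  have hF := (hasDerivAt_discAut hβ1 hβ1).comp z (hdh.comp z hdv)
  have hF' : HasDerivAt (discAut β ∘ (h ∘ v)) _ z := hF
  rw [hF'.deriv]
  have hr1 : 0 < 1 - ‖c‖ := by linarith
  have hr2 : 0 < 1 - ‖c‖ ^ 2 := by nlinarith [norm_nonneg c]
  have hn1 : ‖(1 - (‖β‖ : ℂ) ^ 2) / (1 - (starRingEnd ℂ) β * β) ^ 2‖ = (1 - ‖c‖)⁻¹ := by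
    rw [Complex.conj_mul', sq (1 - (‖β‖ : ℂ) ^ 2), div_mul_cancel_left₀, norm_inv]
    · have : (1 - (‖β‖ : ℂ) ^ 2) = ((1 - ‖c‖ : ℝ) : ℂ) := by
        rw [← hβn]; push_cast; rfl
      rw [this, Complex.norm_real, Real.norm_of_nonneg hr1.le]
    · rw [← Complex.ofReal_pow, hβn]
      exact_mod_cast hr1.ne'
  have hn2 : ‖(1 - (‖c‖ : ℂ) ^ 2)‖ = 1 - ‖c‖ ^ 2 := by
    rw [← Complex.ofReal_pow, ← Complex.ofReal_one, ← Complex.ofReal_sub, Complex.norm_real,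
      Real.norm_of_nonneg hr2.le]
  have hn3 : ‖deriv h (v z)‖ = (2 * ‖β‖)⁻¹ := by
    refine eq_inv_of_mul_eq_one_right ?_
    have := congrArg norm hdh'
    simpa using this
  -- The three factors are `1 - ‖c‖ ^ 2` from the first automorphism, `1 / (2 * √‖c‖)` from the root
  -- and `1 / (1 - ‖c‖)` from the second automorphism.
  rw [norm_mul, norm_mul, norm_mul, hn1, hn2, hn3, hβs]
  have hβp : 0 < ‖β‖ := norm_pos_iff.2 hβ0
  field_simp
  ring

theorem koebeFactor_anti {r s : ℝ} (hr : 0 < r) (hrs : r ≤ s) (hs : s ≤ 1) :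
    (1 + s) / (2 * √s) ≤ (1 + r) / (2 * √r) := by
  have h1 : 0 < √r := Real.sqrt_pos.2 hr
  have h2 : √r ≤ √s := Real.sqrt_le_sqrt hrs
  have h3 : √s ≤ 1 := Real.sqrt_le_one.2 hs
  have h4 := Real.sq_sqrt hr.le
  have h5 := Real.sq_sqrt (hr.le.trans hrs)
  have h6 : 0 < √s := h1.trans_le h2
  rw [div_le_div_iff₀ (by positivity) (by positivity), ← h4, ← h5, Real.sqrt_sq h1.le,
    Real.sqrt_sq h6.le]
  have h7 : √r * √s ≤ 1 := by nlinarith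
  nlinarith [mul_nonneg (sub_nonneg.2 h2) (sub_nonneg.2 h7)]

theorem one_lt_koebeFactor {s : ℝ} (hs : 0 < s) (hs1 : s < 1) : 1 < (1 + s) / (2 * √s) := by
  have h1 : 0 < √s := Real.sqrt_pos.2 hs
  have h2 : √s < 1 := (Real.sqrt_lt' one_pos).2 (by simpa using hs1)
  have h3 := Real.sq_sqrt hs.le
  rw [one_lt_div (by positivity)]
  nlinarith [sq_pos_of_pos (sub_pos.2 h2)]

/-- The squeezing function of a plane domain with connected complement in the sphere, other than
the plane, is equal to `1`. -/
theorem exists_isDiscEmbedding_ball_subset {U : Set ℂ} (hU : IsOpen U) (hUc : IsConnected U)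
    (hE : IsPreconnected (toSphere U)ᶜ) {b : ℂ} (hb : b ∉ U) {z : ℂ} (hz : z ∈ U) {ρ : ℝ}
    (hρ : ρ < 1) : ∃ f, IsDiscEmbedding U z f ∧ ball 0 ρ ⊆ f '' U := by
  wlog hρ0 : 0 < ρ generalizing ρ
  · obtain ⟨f, hf, h⟩ := this (ρ := 1 / 2) (by norm_num) (by norm_num)
    exact ⟨f, hf, (ball_subset_ball (by linarith)).trans h⟩
  let S : Set ℝ := {d | ∃ f, IsFullDiscEmbedding U f ∧ f z = 0 ∧ d = ‖deriv f z‖}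
  obtain ⟨δ, hδ, hball⟩ := Metric.isOpen_iff.1 hU z hz
  have hS : BddAbove S := by
    refine ⟨1 / δ, ?_⟩
    rintro _ ⟨f, hf, hfz, rfl⟩
    refine Complex.norm_deriv_le_div_of_mapsTo_ball (hf.1.mono hball) (fun w hw => ?_) hδ
    rw [hfz]
    exact ball_subset_closedBall (hf.2.2.1 (hball hw))
  obtain ⟨f₀, hf₀⟩ := exists_isFullDiscEmbedding hU hUc hE hb
  have hf₀z : ‖f₀ z‖ < 1 := by simpa using hf₀.2.2.1 hz
  have hf₁ := hf₀.discAut_comp hf₀z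
  have hS₁ : ‖deriv (discAut (f₀ z) ∘ f₀) z‖ ∈ S := ⟨_, hf₁, by simp, rfl⟩
  have hM : 0 < sSup S := (norm_pos_iff.2 (deriv_ne_zero_of_injOn hU hf₁.1 hf₁.2.1 hz)).trans_le
    (le_csSup hS hS₁)
  have hk := one_lt_koebeFactor hρ0 hρ
  set k := (1 + ρ) / (2 * √ρ) with hkdef
  have hk0 : 0 < k := one_pos.trans hk
  -- A derivative within the factor `k` of the supremum is enough: an omitted value of modulus below
  -- `ρ` would allow a gain of at least `k` and exceed the supremum.
  obtain ⟨_, ⟨f, hf, hfz, rfl⟩, hlt⟩ :=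
    exists_lt_of_lt_csSup ⟨_, hS₁⟩ (show sSup S / k < sSup S from div_lt_self hM hk)
  refine ⟨f, ⟨hf.1, hf.2.1, hf.2.2.1, hfz⟩, fun c hc => ?_⟩
  by_contra hcU
  have hcρ : ‖c‖ < ρ := by simpa using hc
  obtain ⟨F, hF, hFz, hFd⟩ := hf.exists_deriv_eq hU hUc hz hfz hcU (hcρ.trans hρ)
  have hc0 : 0 < ‖c‖ := norm_pos_iff.2 fun h => hcU (h ▸ ⟨z, hz, hfz⟩)
  have h1 : ‖deriv F z‖ ≤ sSup S := le_csSup hS ⟨F, hF, hFz, rfl⟩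
  have h2 := koebeFactor_anti hc0 hcρ.le hρ.le
  rw [div_lt_iff₀ hk0] at hlt
  rw [hFd] at h1
  have h3 := mul_le_mul_of_nonneg_right h2 (norm_nonneg (deriv f z))
  linarith

/-! ### Basic properties of the squeezing function -/

theorem le_one_of_ball_subset {D : Set ℂ} {p : ℂ} {f : ℂ → ℂ} (hf : IsDiscEmbedding D p f) {r : ℝ}
    (hr : ball 0 r ⊆ f '' D) : r ≤ 1 := by
  by_contra! h
  have h1 : (1 : ℂ) ∈ f '' D := hr (by simpa using h)
  obtain ⟨z, hz, h1⟩ := h1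
  have := hf.2.2.1 hz
  simp [h1] at this

theorem squeezingOf_nonneg {D : Set ℂ} {p : ℂ} {f : ℂ → ℂ} (hf : IsDiscEmbedding D p f) :
    0 ≤ squeezingOf D f :=
  le_csSup ⟨1, fun _ hr => le_one_of_ball_subset hf hr⟩ (by simp)

theorem squeezing_nonneg (D : Set ℂ) (p : ℂ) : 0 ≤ squeezing D p := by
  refine Real.sSup_nonneg ?_
  rintro _ ⟨f, hf, rfl⟩
  exact squeezingOf_nonneg hf

theorem squeezing_le {D : Set ℂ} {p : ℂ} {C : ℝ} (hC : 0 ≤ C)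
    (h : ∀ f, IsDiscEmbedding D p f → ∀ r, ball 0 r ⊆ f '' D → r ≤ C) : squeezing D p ≤ C := by
  refine Real.sSup_le ?_ hC
  rintro _ ⟨f, hf, rfl⟩
  exact Real.sSup_le (fun r hr => h f hf r hr) hC

theorem squeezing_le_one (D : Set ℂ) (p : ℂ) : squeezing D p ≤ 1 :=
  squeezing_le zero_le_one fun _ hf _ hr => le_one_of_ball_subset hf hr

theorem le_squeezing {D : Set ℂ} {p : ℂ} {f : ℂ → ℂ} (hf : IsDiscEmbedding D p f) {r : ℝ}
    (hr : ball 0 r ⊆ f '' D) : r ≤ squeezing D p := by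
  have h1 : r ≤ squeezingOf D f := le_csSup ⟨1, fun _ hr => le_one_of_ball_subset hf hr⟩ hr
  refine h1.trans (le_csSup ⟨1, ?_⟩ ⟨f, hf, rfl⟩)
  rintro _ ⟨g, hg, rfl⟩
  exact Real.sSup_le (fun r hr => le_one_of_ball_subset hg hr) zero_le_one

/-- The squeezing function of a plane domain that embeds into the disc is locally bounded away
from zero. -/
theorem eventually_le_squeezing {D : Set ℂ} (hD : IsOpen D) {p z₀ : ℂ} (hz₀ : z₀ ∈ D) {f : ℂ → ℂ}
    (hf : IsDiscEmbedding D p f) : ∃ c > 0, ∀ᶠ z in 𝓝 z₀, z ∈ D → c ≤ squeezing D z := by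
  obtain ⟨hd, hi, hm, -⟩ := hf
  have hopen := isOpen_image_of_injOn hD hd hi hD Subset.rfl
  obtain ⟨r', hr', hball'⟩ := Metric.isOpen_iff.1 hopen (f z₀) (mem_image_of_mem f hz₀)
  obtain ⟨r, hr, hr1, hball⟩ : ∃ r > 0, r ≤ 1 ∧ ball (f z₀) r ⊆ f '' D :=
    ⟨min r' 1, by positivity, min_le_right _ _, (ball_subset_ball (min_le_left _ _)).trans hball'⟩
  -- For `‖w‖ < r / 4 ≤ 1 / 4` the denominator of `discAut (-f z) w` has modulus at least `1 / 2`.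
  -- This point is therefore within `r / 2` of `f z`, which is itself within `r / 2` of `f z₀`.
  refine ⟨r / 4, by positivity, ?_⟩
  have hc := (hd.differentiableAt (hD.mem_nhds hz₀)).continuousAt
  filter_upwards [hc (ball_mem_nhds _ (half_pos hr))] with z hz hzD
  have ha : ‖f z‖ < 1 := by simpa using hm hzD
  have ha' : ‖-f z‖ < 1 := by simpa using ha
  refine le_squeezing (f := discAut (f z) ∘ f) ⟨(differentiableOn_discAut ha).comp hd hm,
    (injOn_discAut ha).comp hi hm, (mapsTo_discAut ha).comp hm, by simp⟩ fun w hw => ?_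
  have hw4 : ‖w‖ < r / 4 := by simpa using hw
  have hw1 : ‖w‖ < 1 := by linarith
  have hne := one_sub_conj_mul_ne_zero ha' hw1
  have hlow : 1 / 2 ≤ ‖1 - (starRingEnd ℂ) (-f z) * w‖ := by
    have h1 := norm_sub_norm_le 1 ((starRingEnd ℂ) (-f z) * w)
    rw [norm_mul, RCLike.norm_conj, norm_one] at h1
    nlinarith [norm_nonneg w, norm_nonneg (-f z)]
  have heq : discAut (-f z) w - f z =
      w * (1 - (starRingEnd ℂ) (f z) * f z) / (1 - (starRingEnd ℂ) (-f z) * w) := by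
    rw [discAut, div_sub' hne]
    congr 1
    rw [map_neg]
    ring
  have hnum : ‖1 - (starRingEnd ℂ) (f z) * f z‖ ≤ 1 := by
    have h2 : 0 ≤ 1 - ‖f z‖ ^ 2 := by nlinarith [norm_nonneg (f z)]
    rw [Complex.conj_mul', ← Complex.ofReal_pow, ← Complex.ofReal_one, ← Complex.ofReal_sub,
      Complex.norm_real, Real.norm_of_nonneg h2]
    nlinarith [norm_nonneg (f z)]
  have hdist : ‖discAut (-f z) w - f z‖ < r / 2 := by
    rw [heq, norm_div, norm_mul, div_lt_iff₀ (by linarith)]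
    nlinarith [norm_nonneg w]
  obtain ⟨v, hv, hvw⟩ := hball (show discAut (-f z) w ∈ ball (f z₀) r by
    rw [mem_ball]
    have h3 : dist (f z) (f z₀) < r / 2 := hz
    have h4 := dist_triangle (discAut (-f z) w) (f z) (f z₀)
    rw [dist_eq_norm (discAut (-f z) w) (f z)] at h4
    linarith)
  exact ⟨v, hv, by rw [Function.comp_apply, hvw, discAut_discAut_neg ha hw1]⟩

/-! ### Isolated boundary points -/

/-- Removable singularities of bounded injective functions. -/
theorem exists_removable_extension {g : ℂ → ℂ} {a : ℂ} {s : Set ℂ} (hs : s ∈ 𝓝 a)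
    (hd : DifferentiableOn ℂ g (s \ {a})) (hi : InjOn g (s \ {a}))
    (hm : MapsTo g (s \ {a}) (ball 0 1)) :
    ∃ l, ‖l‖ < 1 ∧ Tendsto g (𝓝[≠] a) (𝓝 l) ∧ DifferentiableAt ℂ (Function.update g a l) a := by
  have hupd := Complex.differentiableOn_update_limUnder_of_bddAbove hs hd ⟨1, by
    rintro _ ⟨z, hz, rfl⟩
    exact (mem_ball_zero_iff.1 (hm hz)).le⟩
  set l := limUnder (𝓝[≠] a) g with hl
  have hda := hupd.differentiableAt hs
  have ht : Tendsto g (𝓝[≠] a) (𝓝 l) := continuousAt_update_same.1 hda.continuousAt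
  have hs' : ∀ᶠ z in 𝓝[≠] a, z ∈ s \ {a} :=
    inter_mem (nhdsWithin_le_nhds hs) self_mem_nhdsWithin
  refine ⟨l, ?_, ht, hda⟩
  have hl1 : ‖l‖ ≤ 1 := le_of_tendsto ht.norm (hs'.mono fun z hz =>
    (mem_ball_zero_iff.1 (hm hz)).le)
  -- The limit so far has modulus at most `1`. Injectivity excludes the constant case, and openness
  -- then places `l` in the interior of the closed disc.
  rcases (hupd.analyticAt hs).eventually_constant_or_nhds_le_map_nhds with h | h
  · exfalso
    have h1 : ∀ᶠ z in 𝓝[≠] a, z ∈ s \ {a} ∧ g z = l := by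
      filter_upwards [hs', h.filter_mono nhdsWithin_le_nhds] with z hz hz'
      exact ⟨hz, by simpa [Function.update_of_ne hz.2] using hz'⟩
    obtain ⟨x, hx, hxl⟩ := h1.exists
    have hxa : a ≠ x := fun h => hx.2 h.symm
    obtain ⟨y, ⟨hy, hyl⟩, hyx⟩ := (h1.and
      ((isOpen_ne.eventually_mem hxa).filter_mono nhdsWithin_le_nhds)).exists
    exact hyx (hi hy hx (hyl.trans hxl.symm))
  · rw [Function.update_self] at h
    have h2 : closedBall (0 : ℂ) 1 ∈ 𝓝 l := by
      refine h (mem_map.2 (mem_of_superset hs fun z hz => ?_))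
      by_cases hza : z = a
      · subst hza
        simpa using hl1
      · simpa [Function.update_of_ne hza] using ball_subset_closedBall (hm ⟨hz, hza⟩)
    have h3 := mem_interior_iff_mem_nhds.2 h2
    rwa [interior_closedBall _ one_ne_zero, mem_ball_zero_iff] at h3

-- Removability at `p` is treated in an arbitrary chart `c`, so that finite punctures and the
-- puncture `∞` share one argument.
open scoped Classical in
theorem exists_extension_in_chart {D : Set ℂ} (hD : IsOpen D) {p : RiemannSphere}
    (hp : p ∉ toSphere D) (hX : IsOpen (toSphere D ∪ {p})) {f : ℂ → ℂ}
    (hd : DifferentiableOn ℂ f D) (hi : InjOn f D) (hm : MapsTo f D (ball 0 1))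
    {c : ℂ → RiemannSphere} {a : ℂ} (hc : Continuous c) (hci : Function.Injective c) (hca : c a = p)
    (hcd : ∀ w, c w ∈ toSphere D → DifferentiableAt ℂ (fun w => affineCoord (c w)) w) :
    ∃ l, ‖l‖ < 1 ∧ l ∉ f '' D ∧
      DifferentiableAt ℂ (fun w => if c w = p then l else f (affineCoord (c w))) a := by
  set s := c ⁻¹' (toSphere D ∪ {p}) with hs
  have hsa : s ∈ 𝓝 a := (hX.preimage hc).mem_nhds (by simp [hca])
  have hsD : ∀ w ∈ s \ {a}, c w ∈ toSphere D := by
    rintro w ⟨hw | hw, hwa⟩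
    · exact hw
    · exact absurd (hci (hw.trans hca.symm)) hwa
  have hsD' : ∀ w ∈ s \ {a}, affineCoord (c w) ∈ D ∧ (affineCoord (c w) : RiemannSphere) = c w := by
    intro w hw
    obtain ⟨v, hv, h⟩ := hsD w hw
    rw [← h]
    exact ⟨hv, rfl⟩
  obtain ⟨l, hl, ht, hdl⟩ := exists_removable_extension (g := fun w => f (affineCoord (c w))) hsa
    (fun w hw => ((hd.differentiableAt (hD.mem_nhds (hsD' w hw).1)).comp w
      (hcd w (hsD w hw))).differentiableWithinAt)
    (fun x hx y hy hxy => hci (by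
      rw [← (hsD' x hx).2, ← (hsD' y hy).2, hi (hsD' x hx).1 (hsD' y hy).1 hxy]))
    (fun w hw => hm (hsD' w hw).1)
  refine ⟨l, hl, ?_, ?_⟩
  -- If `l = f z` with `z ∈ D`, then `f` takes all values near `l` at points near `z`. The values
  -- taken near `p` also tend to `l`, which contradicts injectivity.
  · rintro ⟨z, hz, rfl⟩
    have hpz : p ≠ (z : RiemannSphere) := fun h => hp (h ▸ coe_mem_toSphere.2 hz)
    obtain ⟨N, V, hN, hV, hpN, hzV, hNV⟩ := t2_separation hpz
    have h1 : f '' (D ∩ (fun w : ℂ => (w : RiemannSphere)) ⁻¹' V) ∈ 𝓝 (f z) :=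
      nhds_le_map_nhds_of_injOn hD hd hi hz (image_mem_map
        (inter_mem (hD.mem_nhds hz) ((hV.preimage OnePoint.continuous_coe).mem_nhds hzV)))
    have h2 : ∀ᶠ w in 𝓝[≠] a, w ∈ s \ {a} ∧ c w ∈ N :=
      Eventually.and (inter_mem (nhdsWithin_le_nhds hsa) self_mem_nhdsWithin)
        (((hN.preimage hc).eventually_mem (by simpa [hca] using hpN)).filter_mono
          nhdsWithin_le_nhds)
    obtain ⟨w, ⟨v, ⟨hvD, hvV⟩, hvw⟩, hw, hwN⟩ := ((ht.eventually h1).and h2).exists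
    have h3 := hi hvD (hsD' w hw).1 hvw
    refine Set.disjoint_left.1 hNV hwN ?_
    rw [← (hsD' w hw).2, ← h3]
    exact hvV
  · convert hdl using 1
    funext w
    by_cases hw : w = a
    · simp [hw, hca]
    · have : c w ≠ p := fun h => hw (hci (h.trans hca.symm))
      simp [this, Function.update_of_ne hw]

/-- A disc embedding of a plane domain extends holomorphically to isolated points of the
complement. -/
theorem exists_extension {D : Set ℂ} (hD : IsOpen D) {p : RiemannSphere}
    (hp : p ∉ toSphere D) (hX : IsOpen (toSphere D ∪ {p})) {f : ℂ → ℂ}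
    (hd : DifferentiableOn ℂ f D) (hi : InjOn f D) (hm : MapsTo f D (ball 0 1)) :
    ∃ F : RiemannSphere → ℂ, DifferentiableOnSphere F (toSphere D ∪ {p}) ∧
      MapsTo F (toSphere D ∪ {p}) (ball 0 1) ∧ (∀ z ∈ D, F z = f z) ∧ F p ∉ f '' D := by
  classical
  suffices h : ∃ l, ‖l‖ < 1 ∧ l ∉ f '' D ∧ DifferentiableOnSphere
      (fun x => if x = p then l else f (affineCoord x)) (toSphere D ∪ {p}) by
    obtain ⟨l, hl, hlD, hF⟩ := h
    have hF' : ∀ z ∈ D, (if (z : RiemannSphere) = p then l else f (affineCoord z)) = f z := by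
      intro z hz
      rw [if_neg (ne_of_mem_of_not_mem (coe_mem_toSphere.2 hz) hp), affineCoord_coe]
    refine ⟨_, hF, ?_, hF', by simpa using hlD⟩
    rintro _ (⟨z, hz, rfl⟩ | rfl)
    · simp only [hF' z hz]
      exact hm hz
    · simpa using hl
  have hDpt : ∀ l, ∀ z ∈ D,
      DifferentiableAt ℂ (fun w : ℂ => if (w : RiemannSphere) = p then l else
        f (affineCoord w)) z := by
    intro l z hz
    refine (hd.differentiableAt (hD.mem_nhds hz)).congr_of_eventuallyEq ?_
    filter_upwards [hD.mem_nhds hz] with w hw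
    rw [if_neg (ne_of_mem_of_not_mem (coe_mem_toSphere.2 hw) hp), affineCoord_coe]
  induction p using OnePoint.rec with
  | infty =>
    obtain ⟨l, hl, hlD, h⟩ := exists_extension_in_chart hD hp hX hd hi hm
      (c := fun w => sphereInv w) (a := 0) (continuous_sphereInv.comp OnePoint.continuous_coe)
      (sphereInvHomeo.injective.comp OnePoint.coe_injective) sphereInv_zero (fun w hw => by
        have hw0 : w ≠ 0 := by
          rintro rfl
          simp at hw
        refine (differentiableAt_inv hw0).congr_of_eventuallyEq ?_
        filter_upwards [isOpen_ne.mem_nhds hw0] with v hv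
        rw [sphereInv_coe hv, affineCoord_coe])
    refine ⟨l, hl, hlD, fun z hz => hDpt l z (by simpa using hz), fun _ => h⟩
  | coe q =>
    obtain ⟨l, hl, hlD, h⟩ := exists_extension_in_chart hD hp hX hd hi hm
      (c := fun w => w) (a := q) OnePoint.continuous_coe OnePoint.coe_injective rfl
      (fun w _ => differentiableAt_id)
    refine ⟨l, hl, hlD, fun z hz => ?_, fun h => by simp at h⟩
    rcases hz with hz | hz
    · exact hDpt l z (by simpa using hz)
    · rw [mem_singleton_iff, OnePoint.coe_eq_coe] at hz
      subst hz
      exact h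

theorem squeezing_le_tanh {D : Set ℂ} (hD : IsOpen D) {p : RiemannSphere}
    (hp : p ∉ toSphere D) (hX : IsOpen (toSphere D ∪ {p})) (hXc : IsConnected (toSphere D ∪ {p}))
    {z : ℂ} (hz : z ∈ D) :
    squeezing D z ≤ Real.tanh (kobayashiDist (toSphere D ∪ {p}) (z : RiemannSphere) p / 2) := by
  have hz' : (z : RiemannSphere) ∈ toSphere D ∪ {p} := Or.inl (coe_mem_toSphere.2 hz)
  have hp' : p ∈ toSphere D ∪ {p} := Or.inr rfl
  refine squeezing_le ?_ fun f hf r hr => ?_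
  · rw [← Real.tanh_zero]
    exact tanh_monotone (div_nonneg (kobayashiDist_nonneg _ _ _) zero_le_two)
  obtain ⟨F, hF, hFm, hFf, hFp⟩ := exists_extension hD hp hX hf.1 hf.2.1 hf.2.2.1
  have h1 : r ≤ ‖F p‖ := by
    by_contra! h
    exact hFp (hr (by simpa using h))
  rw [norm_eq_tanh_poincareDist (by simpa using hFm hp')] at h1
  refine h1.trans (tanh_monotone (div_le_div_of_nonneg_right ?_ zero_le_two))
  -- Existence of a chain matters here, since the infimum of the empty set is `0` by convention.
  refine le_csInf (exists_discChain hX hXc.isPreconnected hz' hp') fun L hL => ?_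
  have := DiscChain.poincareDist_le hF hFm hL
  rwa [hFf z hz, hf.2.2.2] at this

theorem tendsto_squeezing_zero {D : Set ℂ} (hD : IsOpen D) {p : RiemannSphere}
    (hp : p ∉ toSphere D) (hX : IsOpen (toSphere D ∪ {p})) (hXc : IsConnected (toSphere D ∪ {p})) :
    Tendsto (squeezing D) (approach D {p}) (𝓝 0) := by
  have hp' : p ∈ toSphere D ∪ {p} := Or.inr rfl
  rw [tendsto_order]
  refine ⟨fun a ha => Eventually.of_forall fun z => ha.trans_le (squeezing_nonneg D z),
    fun a ha => ?_⟩
  obtain ⟨δ, hδ, hδ1, hδa⟩ : ∃ δ : ℝ, 0 < δ ∧ δ < 1 ∧ δ < a :=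
    ⟨min a 1 / 2, by positivity, by linarith [min_le_right a 1],
      (half_lt_self (by positivity)).trans_le (min_le_left a 1)⟩
  rw [approach, nhdsSet_singleton, eventually_inf_principal]
  filter_upwards [tendsto_comap.eventually (eventually_discChain hX hp' hδ hδ1)] with z hz hzD
  obtain ⟨L, hL, hch⟩ := (hz z).2 0 (.refl _ (Or.inl (coe_mem_toSphere.2 hzD)))
  refine ((squeezing_le_tanh hD hp hX hXc hzD).trans (tanh_monotone (b := sigma δ / 2) ?_)).trans_lt
    ((tanh_half_sigma hδ.le hδ1).trans_lt hδa)
  have := kobayashiDist_le hch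
  linarith

/-! ### Components of the complement of a finitely connected domain -/

section Components

variable {D : Set ℂ}

theorem isPreconnected_of_mem_complementComponents {E : Set RiemannSphere}
    (hE : E ∈ complementComponents D) : IsPreconnected E := by
  obtain ⟨x, -, rfl⟩ := hE
  exact isPreconnected_connectedComponentIn

theorem nonempty_of_mem_complementComponents {E : Set RiemannSphere}
    (hE : E ∈ complementComponents D) : E.Nonempty := by
  obtain ⟨x, hx, rfl⟩ := hE
  exact connectedComponentIn_nonempty_iff.2 hx

theorem subset_of_mem_complementComponents {E : Set RiemannSphere}
    (hE : E ∈ complementComponents D) : E ⊆ (toSphere D)ᶜ := by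
  obtain ⟨x, -, rfl⟩ := hE
  exact connectedComponentIn_subset _ _

theorem isClosed_of_mem_complementComponents (hD : IsOpen D) {E : Set RiemannSphere}
    (hE : E ∈ complementComponents D) : IsClosed E := by
  obtain ⟨x, hx, rfl⟩ := hE
  refine closure_subset_iff_isClosed.1
    (isPreconnected_connectedComponentIn.closure.subset_connectedComponentIn
      (subset_closure (mem_connectedComponentIn hx)) ?_)
  exact (isOpen_toSphere hD).isClosed_compl.closure_subset_iff.2 (connectedComponentIn_subset _ _)

theorem exists_mem_complementComponents {x : RiemannSphere} (hx : x ∉ toSphere D) :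
    ∃ E ∈ complementComponents D, x ∈ E :=
  ⟨_, ⟨x, hx, rfl⟩, mem_connectedComponentIn hx⟩

theorem eq_of_mem_complementComponents {E E' : Set RiemannSphere}
    (hE : E ∈ complementComponents D) (hE' : E' ∈ complementComponents D) {x : RiemannSphere}
    (hx : x ∈ E) (hx' : x ∈ E') : E = E' := by
  obtain ⟨y, -, rfl⟩ := hE
  obtain ⟨y', -, rfl⟩ := hE'
  rw [connectedComponentIn_eq hx, connectedComponentIn_eq hx']

theorem compl_union_component {E : Set RiemannSphere} (hE : E ∈ complementComponents D) :
    (toSphere D ∪ E)ᶜ = ⋃₀ (complementComponents D \ {E}) := by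
  ext x
  simp only [mem_compl_iff, mem_union, not_or, mem_sUnion, Set.mem_sdiff, mem_singleton_iff]
  constructor
  · rintro ⟨h1, h2⟩
    obtain ⟨E', hE', hx⟩ := exists_mem_complementComponents h1
    exact ⟨E', ⟨hE', fun h => h2 (h ▸ hx)⟩, hx⟩
  · rintro ⟨E', ⟨hE', hne⟩, hx⟩
    exact ⟨subset_of_mem_complementComponents hE' hx,
      fun h => hne (eq_of_mem_complementComponents hE' hE hx h)⟩

/-- Finiteness enters here: the rest of the complement is a finite union of closed components. -/
theorem isOpen_union_component (hD : IsOpen D) (hfin : FinitelyConnected D)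
    {E : Set RiemannSphere} (hE : E ∈ complementComponents D) : IsOpen (toSphere D ∪ E) := by
  rw [← isClosed_compl_iff, compl_union_component hE, sUnion_eq_biUnion]
  exact Set.Finite.isClosed_biUnion (hfin.subset sdiff_subset)
    fun E' hE' => isClosed_of_mem_complementComponents hD hE'.1

/-- Otherwise `E` would equal `(toSphere D ∪ E) \ closure (toSphere D)`, hence be open as well as
closed in the connected sphere. -/
theorem exists_mem_closure_component (hD : IsPlanarDomain D) (hfin : FinitelyConnected D)
    {E : Set RiemannSphere} (hE : E ∈ complementComponents D) :
    ∃ x ∈ E, x ∈ closure (toSphere D) := by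
  by_contra! hcon
  have hopen : IsOpen E := by
    have : E = (toSphere D ∪ E) ∩ (closure (toSphere D))ᶜ := by
      ext x
      constructor
      · exact fun hx => ⟨Or.inr hx, hcon x hx⟩
      · rintro ⟨hx | hx, h⟩
        · exact absurd (subset_closure hx) h
        · exact hx
    rw [this]
    exact (isOpen_union_component hD.1 hfin hE).inter isClosed_closure.isOpen_compl
  have := IsClopen.eq_univ ⟨isClosed_of_mem_complementComponents hD.1 hE, hopen⟩
    (nonempty_of_mem_complementComponents hE)
  obtain ⟨z, hz⟩ := hD.2.nonempty
  exact subset_of_mem_complementComponents hE (this ▸ mem_univ (z : RiemannSphere))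
    (coe_mem_toSphere.2 hz)

theorem isConnected_union_component (hD : IsPlanarDomain D) (hfin : FinitelyConnected D)
    {E : Set RiemannSphere} (hE : E ∈ complementComponents D) :
    IsConnected (toSphere D ∪ E) := by
  obtain ⟨x, hxE, hx⟩ := exists_mem_closure_component hD hfin hE
  have hDc := isConnected_toSphere hD.2
  refine ⟨hDc.nonempty.inl, ?_⟩
  have h1 : IsPreconnected (insert x (toSphere D)) :=
    hDc.isPreconnected.subset_closure (subset_insert _ _) (insert_subset hx subset_closure)
  have h2 := h1.union x (mem_insert _ _) hxE (isPreconnected_of_mem_complementComponents hE)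
  rwa [insert_union, insert_eq_of_mem (mem_union_right _ hxE)] at h2

/-- The complement of `E` is the union of `D` and the connected sets `D ∪ E'` over the other
components `E'`, all of which contain `D`. -/
theorem isConnected_compl_component (hD : IsPlanarDomain D) (hfin : FinitelyConnected D)
    {E : Set RiemannSphere} (hE : E ∈ complementComponents D) : IsConnected Eᶜ := by
  obtain ⟨z, hz⟩ := hD.2.nonempty
  have hDE : toSphere D ⊆ Eᶜ := subset_compl_comm.1 (subset_of_mem_complementComponents hE)
  have hzD : (z : RiemannSphere) ∈ toSphere D := coe_mem_toSphere.2 hz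
  refine ⟨⟨z, hDE hzD⟩, isPreconnected_of_forall (z : RiemannSphere) fun y hy => ?_⟩
  by_cases hyD : y ∈ toSphere D
  · exact ⟨toSphere D, hDE, hzD, hyD, (isConnected_toSphere hD.2).isPreconnected⟩
  · obtain ⟨E', hE', hyE'⟩ := exists_mem_complementComponents hyD
    refine ⟨toSphere D ∪ E', union_subset hDE fun w hw hwE => hy ?_, Or.inl hzD, Or.inr hyE',
      (isConnected_union_component hD hfin hE').isPreconnected⟩
    rwa [eq_of_mem_complementComponents hE hE' hwE hw]

theorem neBot_approach_component (hD : IsPlanarDomain D) (hfin : FinitelyConnected D)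
    {E : Set RiemannSphere} (hE : E ∈ complementComponents D) : (approach D E).NeBot := by
  obtain ⟨x, hxE, hx⟩ := exists_mem_closure_component hD hfin hE
  rw [approach, inf_principal_neBot_iff]
  rintro s ⟨t, ht, hts⟩
  obtain ⟨_, hyt, z, hz, rfl⟩ := mem_closure_iff_nhds.1 hx t (nhds_le_nhdsSet hxE ht)
  exact ⟨z, hts hyt, hz⟩

/-- A Möbius transformation carries the complement of a nondegenerate component to a plane domain
with connected complement, other than the plane. -/
theorem exists_planar_model (hD : IsPlanarDomain D) (hfin : FinitelyConnected D)
    {E : Set RiemannSphere} (hE : E ∈ complementComponents D) (hE1 : ∀ p, E ≠ {p}) :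
    ∃ (U : Set ℂ) (μ : ℂ → ℂ) (b : ℂ), IsOpen U ∧ IsConnected U ∧ IsPreconnected (toSphere U)ᶜ ∧
      b ∉ U ∧ DifferentiableOn ℂ μ D ∧ InjOn μ D ∧ MapsTo μ D U ∧ IsCompact (U \ μ '' D) ∧
      ∀ C ⊆ U, IsCompact C → ∀ᶠ z in approach D E, μ z ∉ C := by
  have hEne := nonempty_of_mem_complementComponents hE
  have hnt : E.Nontrivial := by
    by_contra h
    obtain ⟨x, hx⟩ := hEne
    exact hE1 x ((not_nontrivial_iff.1 h).eq_singleton_of_mem hx)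
  -- Two points of `E` are used: a finite one, `q`, is sent to `∞` to make the model planar, and
  -- another, `e`, yields the omitted finite value `b`.
  obtain ⟨x, hx, hxi⟩ := hnt.exists_ne OnePoint.infty
  obtain ⟨q, rfl⟩ := OnePoint.ne_infty_iff_exists.1 hxi
  obtain ⟨e, he, heq⟩ := hnt.exists_ne (q : RiemannSphere)
  let m := sphereMoebius 0 1 q one_ne_zero
  have hmq : m q = OnePoint.infty := sphereMoebius_self one_ne_zero
  obtain ⟨b, hb⟩ := OnePoint.ne_infty_iff_exists.1
    (show m e ≠ OnePoint.infty from fun h => heq (m.injective (h.trans hmq.symm)))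
  have himg : ∀ S : Set RiemannSphere, (q : RiemannSphere) ∉ S →
      toSphere ((fun z : ℂ => (z : RiemannSphere)) ⁻¹' (m '' S)) = m '' S := by
    intro S hS
    refine image_preimage_eq_of_subset ?_
    rintro _ ⟨y, hy, rfl⟩
    exact OnePoint.ne_infty_iff_exists.1 fun h => hS (m.injective (h.trans hmq.symm) ▸ hy)
  have hqE : (q : RiemannSphere) ∉ Eᶜ := fun h => h hx
  set U := (fun z : ℂ => (z : RiemannSphere)) ⁻¹' (m '' Eᶜ) with hU
  have hUs : toSphere U = m '' Eᶜ := himg _ hqE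
  have hEcl := isClosed_of_mem_complementComponents hD.1 hE
  have hUo : IsOpen U := (m.isOpenMap _ hEcl.isOpen_compl).preimage OnePoint.continuous_coe
  have hDE : toSphere D ⊆ Eᶜ := subset_compl_comm.1 (subset_of_mem_complementComponents hE)
  have hDq : ∀ z ∈ D, z ≠ q := by
    rintro z hz rfl
    exact hqE (hDE (coe_mem_toSphere.2 hz))
  have hμ : ∀ z ∈ D, m z = ((1 / (z - q) : ℂ) : RiemannSphere) := fun z hz => by
    simpa using! sphereMoebius_coe (a := 0) one_ne_zero (hDq z hz)
  have hne : ∀ z ∈ D, z - q ≠ 0 := fun z hz => sub_ne_zero.2 (hDq z hz)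
  refine ⟨U, fun z => 1 / (z - q), b, hUo, ?_, ?_, ?_, ?_, ?_, ?_, ?_, ?_⟩
  · have h1 : IsConnected (m '' Eᶜ) :=
      (isConnected_compl_component hD hfin hE).image m m.continuous.continuousOn
    rw [← hUs] at h1
    exact ⟨h1.nonempty.of_image, (OnePoint.isOpenEmbedding_coe.isInducing.isPreconnected_image).1
      h1.isPreconnected⟩
  · rw [hUs, image_compl_eq m.bijective, compl_compl]
    exact (isPreconnected_of_mem_complementComponents hE).image m m.continuous.continuousOn
  · rintro ⟨y, hy, hyb⟩
    have : y = e := m.injective (hyb.trans hb)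
    exact hy (this ▸ he)
  · exact (differentiableOn_const _).div (differentiableOn_id.sub_const q) hne
  · intro z hz w hw hzw
    have h1 := hne z hz
    have h2 := hne w hw
    simp only [one_div, inv_inj] at hzw
    linear_combination hzw
  · intro z hz
    exact ⟨z, hDE (coe_mem_toSphere.2 hz), hμ z hz⟩
  · have hKE : ∀ x, x ∈ (toSphere D ∪ E)ᶜ ↔ x ∈ Eᶜ ∧ x ∉ toSphere D := fun x => by
      rw [mem_compl_iff, mem_union, not_or, and_comm, mem_compl_iff]
    have hK : IsCompact (toSphere D ∪ E)ᶜ :=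
      (isOpen_union_component hD.1 hfin hE).isClosed_compl.isCompact
    have hK' := hK.image m.continuous
    rw [← himg _ (fun h => hqE ((hKE _).1 h).1)] at hK'
    have hK'' := (OnePoint.isOpenEmbedding_coe.isInducing.isCompact_iff).2 hK'
    convert hK'' using 1
    ext w
    simp only [hU, Set.mem_sdiff, mem_preimage, mem_image]
    constructor
    · rintro ⟨⟨y, hy, hyw⟩, h⟩
      refine ⟨y, (hKE y).2 ⟨hy, ?_⟩, hyw⟩
      rintro ⟨z, hz, rfl⟩
      exact h ⟨z, hz, OnePoint.coe_injective ((hμ z hz).symm.trans hyw)⟩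
    · rintro ⟨y, hy, hyw⟩
      obtain ⟨h1, h2⟩ := (hKE y).1 hy
      refine ⟨⟨y, h1, hyw⟩, ?_⟩
      rintro ⟨z, hz, hzw⟩
      have : y = z := m.injective (by rw [hyw, hμ z hz, ← hzw])
      exact h2 (this ▸ coe_mem_toSphere.2 hz)
  · intro C hCU hC
    have h1 : IsClosed (m ⁻¹' toSphere C) :=
      ((hC.image OnePoint.continuous_coe).isClosed).preimage m.continuous
    have h2 : (m ⁻¹' toSphere C)ᶜ ∈ 𝓝ˢ E := by
      refine h1.isOpen_compl.mem_nhdsSet.2 fun y hy hyC => ?_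
      have h3 : m y ∈ m '' Eᶜ := hUs ▸ image_mono hCU hyC
      exact (m.injective.mem_set_image.1 h3) hy
    rw [approach, eventually_inf_principal]
    filter_upwards [preimage_mem_comap h2] with z hz hzD hzC
    refine hz ?_
    rw [mem_preimage, hμ z hzD]
    exact coe_mem_toSphere.2 hzC

end Components

/-! ### The squeezing function near nondegenerate components -/

/-- If `f k` lies in the disc of radius `ρ` for some `k ∈ K`, then `z` is at bounded hyperbolic
distance from `k`, hence from the base point `z₀`. This confines `z` to a compact set that does not
depend on `f`. -/
theorem exists_isDiscEmbedding_ball_subset_diff {U : Set ℂ} (hU : IsOpen U) (hUc : IsConnected U)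
    (hE : IsPreconnected (toSphere U)ᶜ) {b : ℂ} (hb : b ∉ U) {K : Set ℂ} (hK : IsCompact K)
    (hKU : K ⊆ U) {ρ : ℝ} (hρ : ρ < 1) :
    ∃ C ⊆ U, IsCompact C ∧ ∀ z ∈ U, z ∉ C → ∃ f, IsDiscEmbedding U z f ∧
      ball 0 ρ ⊆ f '' (U \ K) := by
  wlog hρ0 : 0 < ρ generalizing ρ
  · obtain ⟨C, hCU, hC, h⟩ := this (ρ := 1 / 2) (by norm_num) (by norm_num)
    refine ⟨C, hCU, hC, fun z hz hzC => ?_⟩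
    obtain ⟨f, hf, h⟩ := h z hz hzC
    exact ⟨f, hf, (ball_subset_ball (by linarith)).trans h⟩
  obtain ⟨z₀, hz₀⟩ := hUc.nonempty
  -- A bound on chain lengths holds for every map into the disc. This matters because `g` is chosen
  -- only afterwards, depending on `M`.
  obtain ⟨M, hM⟩ := exists_discChain_le_of_isCompact (isOpen_toSphere hU)
    (isConnected_toSphere hUc).isPreconnected (hK.image OnePoint.continuous_coe) (image_mono hKU)
    (coe_mem_toSphere.2 hz₀)
  -- The inverse of `f` is available only on the disc of radius `ρ'`. Rescaling that disc to the
  -- unit disc turns modulus below `ρ` into modulus below `ρ / ρ'`, a bound uniform in `z`.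
  obtain ⟨ρ', hρ', hρ'1⟩ := exists_between hρ
  have hρ'0 : 0 < ρ' := hρ0.trans hρ'
  have hτ : ρ / ρ' < 1 := (div_lt_one hρ'0).2 hρ'
  obtain ⟨R, hR, hR1⟩ := exists_between (Real.tanh_lt_one ((M + sigma (ρ / ρ')) / 2))
  obtain ⟨g, hg, hgR⟩ := exists_isDiscEmbedding_ball_subset hU hUc hE hb hz₀ hR1
  -- Euclidean radius of the disc about `0` of Poincaré radius `M + sigma (ρ / ρ')`; the image of
  -- `g` contains its closure, so `C` is compact in `U`.
  set N := Real.tanh ((M + sigma (ρ / ρ')) / 2) with hN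
  have hNg : closedBall 0 N ⊆ g '' U := (closedBall_subset_ball hR).trans hgR
  refine ⟨Function.invFunOn g U '' closedBall 0 N, ?_, ?_, fun z hz hzC => ?_⟩
  · rintro _ ⟨w, hw, rfl⟩
    exact Function.invFunOn_mem (hNg hw)
  · exact (isCompact_closedBall 0 N).image_of_continuousOn
      ((continuousOn_invFunOn hU hg.1 hg.2.1).mono hNg)
  obtain ⟨f, hf, hfρ⟩ := exists_isDiscEmbedding_ball_subset hU hUc hE hb hz hρ'1
  refine ⟨f, hf, fun w hw => ?_⟩
  obtain ⟨k, hk, rfl⟩ := hfρ (ball_subset_ball hρ'.le hw)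
  refine ⟨k, ⟨hk, fun hkK => hzC ?_⟩, rfl⟩
  have hgn : ∀ {x}, x ∈ U → ‖g x‖ < 1 := fun hx => by simpa using hg.2.2.1 hx
  refine ⟨g z, ?_, hg.2.1.leftInvOn_invFunOn hz⟩
  have h1 : poincareDist 0 (g k) ≤ M := by
    obtain ⟨L, hL, hch⟩ := hM k (mem_image_of_mem _ hkK)
    have := hch.poincareDist_le (differentiableOnSphere_affineCoord_comp hU hg.1) (by
      rintro _ ⟨x, hx, rfl⟩
      exact hg.2.2.1 hx)
    rw [affineCoord_coe, affineCoord_coe, hg.2.2.2] at this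
    exact this.trans hL
  have h2 : poincareDist (g z) (g k) ≤ sigma (ρ / ρ') := by
    let ψ : ℂ → ℂ := fun w => g (Function.invFunOn f U (ρ' * w))
    have hsc : MapsTo (fun w : ℂ => (ρ' : ℂ) * w) (ball 0 1) (f '' U) := by
      intro w hw
      refine hfρ ?_
      rw [mem_ball_zero_iff] at hw ⊢
      rw [norm_mul, Complex.norm_real, Real.norm_of_nonneg hρ'0.le]
      nlinarith
    have hinv : MapsTo (Function.invFunOn f U) (f '' U) U := fun w hw =>
      Function.invFunOn_mem hw
    have hψ : DifferentiableOn ℂ ψ (ball 0 1) :=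
      hg.1.comp ((differentiableOn_invFunOn hU hf.1 hf.2.1).comp (by fun_prop) hsc)
        (hinv.comp hsc)
    have hψm : MapsTo ψ (ball 0 1) (ball 0 1) := hg.2.2.1.comp (hinv.comp hsc)
    have hlt : ‖f k / ρ'‖ < ρ / ρ' := by
      rw [norm_div, Complex.norm_real, Real.norm_of_nonneg hρ'0.le]
      gcongr
      simpa using hw
    have h0 : ψ 0 = g z := by
      simp only [ψ, mul_zero]
      rw [← hf.2.2.2, hf.2.1.leftInvOn_invFunOn hz]
    have hk' : ψ (f k / ρ') = g k := by
      have : (ρ' : ℂ) ≠ 0 := by exact_mod_cast hρ'0.ne'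
      simp only [ψ]
      rw [mul_div_cancel₀ _ this, hf.2.1.leftInvOn_invFunOn hk]
    have := poincareDist_map_le hψ hψm (a := 0) (by simp) (hlt.trans hτ)
    rw [h0, hk', poincareDist_eq 0, discAut_zero_left] at this
    exact this.trans (sigma_mono (norm_nonneg _) hlt.le hτ)
  have h3 : poincareDist 0 (g z) ≤ M + sigma (ρ / ρ') := by
    refine (poincareDist_triangle (by simp) (hgn hk) (hgn hz)).trans (add_le_add h1 ?_)
    rwa [poincareDist_comm]
  rw [mem_closedBall_zero_iff, norm_eq_tanh_poincareDist (hgn hz)]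
  exact tanh_monotone (div_le_div_of_nonneg_right h3 zero_le_two)

theorem tendsto_squeezing_one {D : Set ℂ} (hD : IsPlanarDomain D) (hfin : FinitelyConnected D)
    {E : Set RiemannSphere} (hE : E ∈ complementComponents D) (hE1 : ∀ p, E ≠ {p}) :
    Tendsto (squeezing D) (approach D E) (𝓝 1) := by
  obtain ⟨U, μ, b, hU, hUc, hUE, hb, hμ, hμi, hμm, hK, hC⟩ :=
    exists_planar_model hD hfin hE hE1
  rw [tendsto_order]
  refine ⟨fun a ha => ?_, fun a ha => Eventually.of_forall fun z =>
    (squeezing_le_one D z).trans_lt ha⟩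
  obtain ⟨ρ, haρ, hρ⟩ := exists_between ha
  obtain ⟨C, hCU, hCc, h⟩ :=
    exists_isDiscEmbedding_ball_subset_diff hU hUc hUE hb hK sdiff_subset hρ
  have hDev : ∀ᶠ z in approach D E, z ∈ D :=
    Filter.Eventually.filter_mono inf_le_right (eventually_principal.2 fun _ h => h)
  filter_upwards [hC C hCU hCc, hDev] with z hzC hz
  obtain ⟨f, ⟨hfd, hfi, hfm, hfz⟩, hball⟩ := h (μ z) (hμm hz) hzC
  refine haρ.trans_le (le_squeezing (f := f ∘ μ)
    ⟨hfd.comp hμ hμm, hfi.comp hμi hμm, hfm.comp hμm, hfz⟩ (hball.trans ?_))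
  rw [sdiff_sdiff_right_self, image_comp]
  exact image_mono inter_subset_right

/-- The sphere is compact, so a local lower bound near each of its points suffices: near points of
`D` it is `eventually_le_squeezing`, and near the other points it comes from the limit `1` at their
component. -/
theorem isHolomorphicHomogeneousRegular_of_nondegenerate {D : Set ℂ} (hD : IsPlanarDomain D)
    (hfin : FinitelyConnected D) (hne : ∀ E ∈ complementComponents D, ∀ p, E ≠ {p}) :
    IsHolomorphicHomogeneousRegular D := by
  obtain ⟨z₀, hz₀⟩ := hD.2.nonempty
  obtain ⟨f, hf⟩ : ∃ f, IsDiscEmbedding D z₀ f := by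
    -- The point `∞` is never in `D`, so there is at least one component.
    obtain ⟨E, hE, -⟩ := exists_mem_complementComponents (infty_notMem_toSphere (D := D))
    obtain ⟨U, μ, b, hU, hUc, hUE, hb, hμ, hμi, hμm, -, -⟩ :=
      exists_planar_model hD hfin hE (hne E hE)
    obtain ⟨f, ⟨hfd, hfi, hfm, hfz⟩, -⟩ :=
      exists_isDiscEmbedding_ball_subset hU hUc hUE hb (hμm hz₀) zero_lt_one
    exact ⟨f ∘ μ, hfd.comp hμ hμm, hfi.comp hμi hμm, hfm.comp hμm, hfz⟩
  have key : ∃ c > 0, ∀ z ∈ D, (z : RiemannSphere) ∈ (univ : Set RiemannSphere) →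
      c ≤ squeezing D z := by
    refine isCompact_univ.induction_on
      (p := fun S => ∃ c > 0, ∀ z ∈ D, (z : RiemannSphere) ∈ S → c ≤ squeezing D z)
      ⟨1, one_pos, by simp⟩ ?_ ?_ ?_
    · rintro s t hst ⟨c, hc, h⟩
      exact ⟨c, hc, fun z hz hzs => h z hz (hst hzs)⟩
    · rintro s t ⟨c, hc, h⟩ ⟨c', hc', h'⟩
      refine ⟨min c c', lt_min hc hc', ?_⟩
      rintro z hz (hzs | hzt)
      · exact (min_le_left _ _).trans (h z hz hzs)
      · exact (min_le_right _ _).trans (h' z hz hzt)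
    · intro x _
      rw [nhdsWithin_univ]
      by_cases hx : x ∈ toSphere D
      · obtain ⟨z, hz, rfl⟩ := hx
        obtain ⟨c, hc, h⟩ := eventually_le_squeezing hD.1 hz hf
        refine ⟨_, OnePoint.isOpenMap_coe.image_mem_nhds h, c, hc, ?_⟩
        rintro w hw ⟨v, hv, hvw⟩
        obtain rfl := OnePoint.coe_injective hvw
        exact hv hw
      · obtain ⟨E, hE, hxE⟩ := exists_mem_complementComponents hx
        have h1 := (tendsto_squeezing_one hD hfin hE (hne E hE)).eventually_const_lt
          (show (1 / 2 : ℝ) < 1 by norm_num)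
        rw [approach, eventually_inf_principal] at h1
        obtain ⟨t, ht, hts⟩ := h1
        exact ⟨t, nhds_le_nhdsSet hxE ht, 1 / 2, by norm_num, fun z hz hzt => (hts hzt hz).le⟩
  obtain ⟨c, hc, h⟩ := key
  exact ⟨c, hc, fun z hz => h z hz (mem_univ _)⟩

theorem mainTheorem5 (D : Set ℂ) (hD : IsPlanarDomain D) (hfin : FinitelyConnected D) :
    (∀ E ∈ complementComponents D,
      ((∀ p : RiemannSphere, E ≠ {p}) → Tendsto (squeezing D) (approach D E) (𝓝 1)) ∧
      (∀ p : RiemannSphere, E = {p} →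
        IsOpen (toSphere D ∪ {p}) ∧ IsConnected (toSphere D ∪ {p}) ∧
        (∀ z ∈ D, squeezing D z
          ≤ Real.tanh (kobayashiDist (toSphere D ∪ {p}) (z : RiemannSphere) p / 2)) ∧
        Tendsto (squeezing D) (approach D {p}) (𝓝 0))) ∧
    (IsHolomorphicHomogeneousRegular D ↔
      ∀ E ∈ complementComponents D, ∀ p : RiemannSphere, E ≠ {p}) := by
  have hpoint : ∀ p : RiemannSphere, {p} ∈ complementComponents D →
      IsOpen (toSphere D ∪ {p}) ∧ IsConnected (toSphere D ∪ {p}) ∧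
        (∀ z ∈ D, squeezing D z
          ≤ Real.tanh (kobayashiDist (toSphere D ∪ {p}) (z : RiemannSphere) p / 2)) ∧
        Tendsto (squeezing D) (approach D {p}) (𝓝 0) := by
    intro p hE
    have hp : p ∉ toSphere D := subset_of_mem_complementComponents hE rfl
    have hX := isOpen_union_component hD.1 hfin hE
    have hXc := isConnected_union_component hD hfin hE
    exact ⟨hX, hXc, fun z hz => squeezing_le_tanh hD.1 hp hX hXc hz,
      tendsto_squeezing_zero hD.1 hp hX hXc⟩
  refine ⟨fun E hE => ⟨tendsto_squeezing_one hD hfin hE, ?_⟩, ?_,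
    isHolomorphicHomogeneousRegular_of_nondegenerate hD hfin⟩
  · rintro p rfl
    exact hpoint p hE
  · rintro ⟨c, hc, h⟩ E hE p rfl
    have := neBot_approach_component hD hfin hE
    have hDev : ∀ᶠ z in approach D {p}, z ∈ D :=
      Filter.Eventually.filter_mono inf_le_right (eventually_principal.2 fun _ h => h)
    obtain ⟨z, hz, hzD⟩ := (((hpoint p hE).2.2.2.eventually_lt_const hc).and hDev).exists
    exact hz.not_ge (h z hzD)
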